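/- Consider a loss network with $s$ resources of capacities $b_k\ge 0$ ($k=1,\dots,s$) and $m$ request classes. Class $i$ requests arrive according to independent Poisson processes of rate $\lambda_i>0$, have independent $\exp(\mu_i)$ service times, $\mu_i>0$, pay $r_i\ge 0$ per unit of time in service, and accept any of the allocations $\mathbf b_{i1},\dots,\mathbf b_{il_i}\in\mathbf R_+^s$. Let $\rho_i=\lambda_i/\mu_i$. Let $0<\varepsilon<\frac14$ and let $\boldsymbol\alpha^\varepsilon=(\alpha^\varepsilon_{ij})$ be an optimal solution of the linear program: maximize $\sum_i r_i\rho_i\sum_j\alpha_{ij}$ subject to $\sum_i\rho_i\sum_j b_{ij}(k)\alpha_{ij}\le\frac{1}{1+4\varepsilon}b_k$ for all $k$, $\sum_j\alpha_{ij}\le1$ for all $i$, and $\alpha_{ij}\ge0$. Write $\alpha_i^\varepsilon=\sum_j\alpha_{ij}^\varepsilon$ and put $$c_i^1=(1+4\varepsilon)(1-\alpha_i^\varepsilon)\rho_i,\qquad c_{ik}^0=(1+4\varepsilon)\,\nu_k\Big(\sum_j\alpha_{ij}^\varepsilon b_{ij}(k)\Big)\rho_i,\qquad \nu_k=\frac{\frac{1}{1+4\varepsilon}b_k}{\sum_{i}\sum_j\alpha^\varepsilon_{ij}\rho_i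 b_{ij}(k)}$$ (with $c^0_{ik}=0$ for all $i$ if the denominator of $\nu_k$ vanishes). Let $\beta>0$ satisfy $\beta\le\varepsilon\, c_{ik}^0/b_{ij}(k)$ for all $i,j,k$ with $b_{ij}(k)>0$, and $\beta\le\varepsilon\, c_i^1$ for all $i$ with $\alpha_i^\varepsilon<1$. The penalty policy $\bar\pi$ adds to the network a fictitious system of infinite capacity. Let $\bar x_{ij}(t)$ be the number of class $i$ requests in the network at time $t$ that are assigned to $\mathbf b_{ij}$, and $\bar y_i(t)$ the number of class $i$ requests in the fictitious system. Put $\Psi_{ik}(\mathbf x_i)=\exp\big(\beta\sum_j x_{ij}b_{ij}(k)/c_{ik}^0\big)$ (equal to $1$ if $b_{ij}(k)=0$ for all $j$) and $\Psi_i(y_i)=\exp(\beta y_i/c_i^1)$. A class $i$ arrival is conditionally accepted if $\min_j\sum_k\partial\Psi_{ik}/\partial x_{ij}\le\partial\Psi_i/\partial y_i$ at the current state (the right-hand side being $+\infty$ if $c_i^1=0$). A conditionally accepted request is assigned to a $\mathbf b_{ij}$ with $j$ attaining this minimum if that allocation fits into the free capacity, that is, $\sum_{i',j'}\mathbf b_{i'j'}\bar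 x_{i'j'}+\mathbf b_{ij}\le\mathbf b$; ties between minimizers are broken by any fixed function of the state. All other requests go to the fictitious system, where class $i$ requests also have independent $\exp(\mu_i)$ service times. Initially the network is empty and the fictitious system holds $\bar y_i(0^-)=(1-\alpha_i^\varepsilon)\rho_i$ requests of class $i$ (these numbers being integers). Then for every $t\ge0$ the reward rate $\bar R(t)=\sum_i r_i\sum_j\bar x_{ij}(t)$ is integrable and satisfies $$\mathbf E[\bar R(t)]\ \ge\ \sum_{i=1}^m\alpha_i^\varepsilon r_i\rho_i(1-e^{-\mu_it})-\zeta\sum_{i=1}^m(1-\alpha_i^\varepsilon)r_i\rho_i-(s+1)^2e^{-\frac{\varepsilon}{2}(\beta-4)}\sum_{i=1}^m r_i\rho_i(1-e^{-\mu_it}),$$ where $\zeta=\Big(\frac{\log(s+1)}{\beta}+1-\frac{\varepsilon}{2}\Big)(1+4\varepsilon)-1$. -/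

import Mathlib

open MeasureTheory ProbabilityTheory Filter Topology
open scoped NNReal

noncomputable section

/-- The data of a loss network with `s` resources and `m` request classes. Class `i` requests arrive
at rate `arrivalRate i`, stay for an exponential time of rate `serviceRate i`, pay `reward i` per
unit time while in the network, and accept any of `numAlloc i` alternative capacity allocations, the
`j`-th of which occupies `alloc i j k` units of resource `k`. -/
structure LossNetwork (m s : ℕ) where
  capacity : Fin s → ℝ
  numAlloc : Fin m → ℕ
  alloc : (i : Fin m) → Fin (numAlloc i) → Fin s → ℝ
  arrivalRate : Fin m → ℝ
  serviceRate : Fin m → ℝ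
  reward : Fin m → ℝ
  capacity_nonneg : ∀ k, 0 ≤ capacity k
  alloc_nonneg : ∀ i j k, 0 ≤ alloc i j k
  arrivalRate_pos : ∀ i, 0 < arrivalRate i
  serviceRate_pos : ∀ i, 0 < serviceRate i
  reward_nonneg : ∀ i, 0 ≤ reward i

namespace LossNetwork

variable {m s : ℕ} (L : LossNetwork m s)

/-- The offered load of class `i`. -/
def load (i : Fin m) : ℝ := L.arrivalRate i / L.serviceRate i

/-! ### The perturbed steady-state linear program -/

/-- Fractions `α i j` of the class `i` load, one for each class and each of its allocations. -/
abbrev Fractions : Type := (i : Fin m) → Fin (L.numAlloc i) → ℝ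

/-- Feasibility for the steady-state linear program with capacities divided by `1 + 4 ε`. -/
structure IsFeasible (ε : ℝ) (α : L.Fractions) : Prop where
  capacity_le : ∀ k, ∑ i, L.load i * ∑ j, L.alloc i j k * α i j ≤ 1 / (1 + 4 * ε) * L.capacity k
  sum_le_one : ∀ i, ∑ j, α i j ≤ 1
  nonneg : ∀ i j, 0 ≤ α i j

/-- The objective of the linear program. -/
def lpObjective (α : L.Fractions) : ℝ := ∑ i, L.reward i * L.load i * ∑ j, α i j

/-- `α` is an optimal solution of the perturbed linear program. -/
def IsOptimal (ε : ℝ) (α : L.Fractions) : Prop :=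
  L.IsFeasible ε α ∧ ∀ α' : L.Fractions, L.IsFeasible ε α' → L.lpObjective α' ≤ L.lpObjective α

/-! ### The target capacities of the penalty function -/

/-- The capacity of the fictitious system for class `i`. -/
def fictCapacity (ε : ℝ) (α : L.Fractions) (i : Fin m) : ℝ :=
  (1 + 4 * ε) * (1 - ∑ j, α i j) * L.load i

/-- The factor by which the usage of resource `k` under `α` can be scaled up until it reaches the
perturbed capacity. For a resource that `α` does not use at all its value plays no role, because
the capacities `resCapacity` of that resource vanish whatever the factor is. -/
def slack (ε : ℝ) (α : L.Fractions) (k : Fin s) : ℝ :=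
  (1 / (1 + 4 * ε) * L.capacity k) / ∑ i, ∑ j, α i j * L.load i * L.alloc i j k

/-- The share of resource `k` that is meant for class `i`. -/
def resCapacity (ε : ℝ) (α : L.Fractions) (i : Fin m) (k : Fin s) : ℝ :=
  (1 + 4 * ε) * L.slack ε α k * (∑ j, α i j * L.alloc i j k) * L.load i

/-- The upper bound on the multiplier `β`: it is at most `ε` times each ratio
`resCapacity i k / alloc i j k` (a ratio with denominator zero is infinite, hence no restriction)
and at most `ε` times `fictCapacity i` for each class `i` that is not fully admitted by `α`. -/
structure IsAdmissible (ε : ℝ) (α : L.Fractions) (β : ℝ) : Prop where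
  le_res : ∀ i j k, 0 < L.alloc i j k → β ≤ ε * (L.resCapacity ε α i k / L.alloc i j k)
  le_fict : ∀ i, ∑ j, α i j < 1 → β ≤ ε * L.fictCapacity ε α i

/-! ### The penalty function and its partial derivatives -/

/-- The penalty of class `i` at resource `k`, as a function of the numbers `x j` of class `i`
requests assigned to the different allocations. If `alloc i j k = 0` for all `j`, it is the
constant `1`. -/
def resPenalty (ε : ℝ) (α : L.Fractions) (β : ℝ) (i : Fin m) (k : Fin s)
    (x : Fin (L.numAlloc i) → ℝ) : ℝ :=
  Real.exp (β * ((∑ j, x j * L.alloc i j k) / L.resCapacity ε α i k))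

/-- The penalty of class `i` in the fictitious system (used only if `fictCapacity i ≠ 0`). -/
def fictPenalty (ε : ℝ) (α : L.Fractions) (β : ℝ) (i : Fin m) (y : ℝ) : ℝ :=
  Real.exp (β * (y / L.fictCapacity ε α i))

/-- The sum over all resources `k` of the partial derivatives of `resPenalty i k` with respect to
the number of requests assigned to allocation `j`. -/
def resMarginal (ε : ℝ) (α : L.Fractions) (β : ℝ) (i : Fin m)
    (x : Fin (L.numAlloc i) → ℝ) (j : Fin (L.numAlloc i)) : ℝ :=
  ∑ k, deriv (fun u : ℝ => L.resPenalty ε α β i k (Function.update x j u)) (x j)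

/-- The derivative of `fictPenalty i`. For a class with `fictCapacity i = 0` it is `+∞`, the limit
as the capacity decreases to zero. -/
def fictMarginal (ε : ℝ) (α : L.Fractions) (β : ℝ) (i : Fin m) (y : ℝ) : EReal :=
  if L.fictCapacity ε α i = 0 then ⊤ else ((deriv (L.fictPenalty ε α β i) y : ℝ) : EReal)

/-! ### The penalty policy -/

/-- States of the augmented network: `st.1 i j` is the number of class `i` requests in the network
that are assigned to their allocation `j`, and `st.2 i` is the number of class `i` requests in the
fictitious system. -/
abbrev State : Type := ((i : Fin m) → Fin (L.numAlloc i) → ℕ) × (Fin m → ℕ)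

/-- There is adequate capacity for one more class `i` request with allocation `j`. -/
def Fits (st : L.State) (i : Fin m) (j : Fin (L.numAlloc i)) : Prop :=
  ∀ k, ∑ i', ∑ j', L.alloc i' j' k * (st.1 i' j' : ℝ) + L.alloc i j k ≤ L.capacity k

/-- `j` minimises the marginal penalty among the allocations of class `i`. -/
def IsCheapest (ε : ℝ) (α : L.Fractions) (β : ℝ) (st : L.State) (i : Fin m)
    (j : Fin (L.numAlloc i)) : Prop :=
  ∀ j', L.resMarginal ε α β i (fun a => (st.1 i a : ℝ)) j ≤
    L.resMarginal ε α β i (fun a => (st.1 i a : ℝ)) j'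

/-- A class `i` request that arrives in state `st` is conditionally accepted: the smallest marginal
penalty of its allocations is at most the marginal penalty of the fictitious system. -/
def CondAccepted (ε : ℝ) (α : L.Fractions) (β : ℝ) (st : L.State) (i : Fin m) : Prop :=
  ∃ j, ((L.resMarginal ε α β i (fun a => (st.1 i a : ℝ)) j : ℝ) : EReal) ≤
    L.fictMarginal ε α β i (st.2 i : ℝ)

/-- A routing rule: where a class `i` request goes that finds the state `st` on arrival, `some j`
for allocation `j` and `none` for the fictitious system. -/
abbrev Rule : Type := (i : Fin m) → L.State → Option (Fin (L.numAlloc i))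

/-- `d` is a penalty rule: a conditionally accepted request selects an allocation of least marginal
penalty and is assigned to it if there is adequate capacity; every other request goes to the
fictitious system. Ties between allocations of least marginal penalty may be broken in any way
(with or without regard to which of them fit). -/
structure IsPenaltyRule (ε : ℝ) (α : L.Fractions) (β : ℝ) (d : L.Rule) : Prop where
  accept : ∀ i st j, d i st = some j →
    L.CondAccepted ε α β st i ∧ L.IsCheapest ε α β st i j ∧ L.Fits st i j
  reject : ∀ i st, d i st = none → L.CondAccepted ε α β st i →
    ∃ j, L.IsCheapest ε α β st i j ∧ ¬ L.Fits st i j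

/-! ### The state process -/

/-- `st` with one more class `i` request at allocation `j`. -/
def State.addReq {L : LossNetwork m s} (st : L.State) (i : Fin m) (j : Fin (L.numAlloc i)) :
    L.State :=
  (Function.update st.1 i (Function.update (st.1 i) j (st.1 i j + 1)), st.2)

/-- `st` with one class `i` request less at allocation `j` (only used if there is one). -/
def State.removeReq {L : LossNetwork m s} (st : L.State) (i : Fin m) (j : Fin (L.numAlloc i)) :
    L.State :=
  (Function.update st.1 i (Function.update (st.1 i) j (st.1 i j - 1)), st.2)

/-- `st` with one more class `i` request in the fictitious system. -/
def State.addFict {L : LossNetwork m s} (st : L.State) (i : Fin m) : L.State :=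
  (st.1, Function.update st.2 i (st.2 i + 1))

/-- `st` with one class `i` request less in the fictitious system (only used if there is one). -/
def State.removeFict {L : LossNetwork m s} (st : L.State) (i : Fin m) : L.State :=
  (st.1, Function.update st.2 i (st.2 i - 1))

/-- The state right after a class `i` request has arrived in state `st` and was routed by `d`. -/
def afterArrival (d : L.Rule) (i : Fin m) (st : L.State) : L.State :=
  match d i st with
  | some j => st.addReq i j
  | none => st.addFict i

/-- The generator of the augmented network under the rule `d`: class `i` requests arrive at rate
`arrivalRate i` and are routed by `d`; each class `i` request, in the network or in the fictitious
system, departs at rate `serviceRate i`, independently of everything else. -/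
def generator (d : L.Rule) (f : L.State → ℝ) (st : L.State) : ℝ :=
  ∑ i, L.arrivalRate i * (f (L.afterArrival d i st) - f st)
  + ∑ i, ∑ j, L.serviceRate i * (st.1 i j : ℝ) * (f (st.removeReq i j) - f st)
  + ∑ i, L.serviceRate i * (st.2 i : ℝ) * (f (st.removeFict i) - f st)

/-- `S` is the state process of the augmented network under the rule `d` when the network is
initially empty and the fictitious system initially holds `y₀ i` requests of class `i`: the
continuous-time Markov chain, relative to the filtration `ℱ`, with the above generator, as the
solution with piecewise constant, right-continuous paths of the martingale problem for finitely
supported test functions. -/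
structure IsStateChain (d : L.Rule) (y₀ : Fin m → ℕ) {Ω : Type*} [mΩ : MeasurableSpace Ω]
    (P : Measure Ω) (ℱ : Filtration ℝ≥0 mΩ) (S : ℝ≥0 → Ω → L.State) : Prop where
  adapted : ∀ t, Measurable[ℱ t] (S t)
  right_cont : ∀ ω t, ∀ᶠ u in 𝓝[≥] t, S u ω = S t ω
  left_lim : ∀ ω t, ∃ st, ∀ᶠ u in 𝓝[<] t, S u ω = st
  initial : ∀ᵐ ω ∂P, S 0 ω = (fun _ _ => 0, y₀)
  martingale : ∀ f : L.State → ℝ, f.support.Finite →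
    Martingale (fun (t : ℝ≥0) ω =>
      f (S t ω) - ∫ u in (0 : ℝ)..(t : ℝ), L.generator d f (S u.toNNReal ω)) ℱ P

/-- The instantaneous reward rate in state `st`. -/
def rewardRate (st : L.State) : ℝ := ∑ i, L.reward i * ∑ j, (st.1 i j : ℝ)

end LossNetwork

end

/-
For each class, the weighted geometric mean of its penalties in the network and of its penalty in
the fictitious system is a Lyapunov function. The rule compares marginal penalties, so an arrival
increases this mean by at most the average increment over the allocations that the linear program
prescribes, while the factor `1 + 4 ε` makes departures outweigh this increment at high levels.
Hence Dynkin's formula and Grönwall's inequality bound its expectation, uniformly in time. While the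
fictitious system holds many requests of class `i`, a rejection forces the mean to be large, or,
if the request was conditionally accepted and does not fit, the averaged penalties of a resource
to be large, so that it is rare. The total number of class `i` requests is an `M/M/∞` queue
whatever the rule does, so the expected reward is an explicit term minus the expected occupancy of
the fictitious system.
-/

noncomputable section

lemma measurable_uncurry_of_continuousWithinAt_Ici {Ω : Type*} [MeasurableSpace Ω]
    {X : ℝ≥0 → Ω → ℝ} (hX : ∀ t, Measurable (X t))
    (hc : ∀ ω t, ContinuousWithinAt (X · ω) (Set.Ici t) t) : Measurable (Function.uncurry X) := by
  refine measurable_of_tendsto_metrizable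
    (f := fun (n : ℕ) (p : ℝ≥0 × Ω) => X (⌈(p.1 : ℝ) * n⌉₊ / n) p.2) (fun n => ?_) ?_
  · have hgrid : Measurable fun p : ℕ × Ω => X (p.1 / n) p.2 :=
      measurable_from_prod_countable_right fun k => hX (k / n)
    have hceil : Measurable fun p : ℝ≥0 × Ω => ⌈(p.1 : ℝ) * n⌉₊ :=
      Nat.measurable_ceil.comp (measurable_fst.coe_nnreal_real.mul_const _)
    exact hgrid.comp (hceil.prodMk measurable_snd)
  · rw [tendsto_pi_nhds]
    rintro ⟨u, ω⟩
    refine (hc ω u).tendsto.comp (tendsto_nhdsWithin_iff.2 ⟨NNReal.tendsto_coe.1 ?_, ?_⟩)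
    · simpa [Function.comp_def] using (tendsto_nat_ceil_mul_div_atTop u.coe_nonneg).comp
        (tendsto_natCast_atTop_atTop (R := ℝ))
    · filter_upwards [eventually_gt_atTop 0] with n hn
      rw [Set.mem_Ici, le_div_iff₀ (by positivity), ← NNReal.coe_le_coe]
      exact_mod_cast Nat.le_ceil ((u : ℝ) * n)

lemma le_add_mul_exp_of_eq_integral {φ ψ : ℝ≥0 → ℝ} {a K : ℝ} (hψ : Continuous ψ)
    (hφ : ∀ t : ℝ≥0, φ t = φ 0 + ∫ u in (0 : ℝ)..t, ψ u.toNNReal)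
    (h : ∀ t, ψ t ≤ a * (K - φ t)) (t : ℝ≥0) :
    φ t ≤ K + (φ 0 - K) * Real.exp (-a * t) := by
  have hψ' : Continuous fun u : ℝ => ψ u.toNNReal := hψ.comp continuous_real_toNNReal
  set Φ : ℝ → ℝ := fun u => φ 0 + ∫ v in (0 : ℝ)..u, ψ v.toNNReal
  have hΦ (u : ℝ≥0) : Φ u = φ u := (hφ u).symm
  have hderiv (u : ℝ) : HasDerivAt (fun u => (Φ u - K) * Real.exp (a * u))
      (ψ u.toNNReal * Real.exp (a * u) + (Φ u - K) * (Real.exp (a * u) * a)) u := by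
    have hΦ' : HasDerivAt Φ (ψ u.toNNReal) u :=
      (hψ'.integral_hasStrictDerivAt 0 u).hasDerivAt.const_add _
    have hexp : HasDerivAt (fun u => Real.exp (a * u)) (Real.exp (a * u) * a) u := by
      simpa using ((hasDerivAt_id u).const_mul a).exp
    exact (hΦ'.sub_const K).mul hexp
  have hanti : AntitoneOn (fun u => (Φ u - K) * Real.exp (a * u)) (Set.Ici 0) := by
    refine antitoneOn_of_deriv_nonpos (convex_Ici 0)
      (fun u _ => (hderiv u).continuousAt.continuousWithinAt)
      (fun u _ => (hderiv u).differentiableAt.differentiableWithinAt) fun u hu => ?_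
    have hu : (u.toNNReal : ℝ) = u := Real.coe_toNNReal u (interior_subset hu)
    have hdrift := h u.toNNReal
    rw [← hΦ, hu] at hdrift
    rw [(hderiv u).deriv]
    linarith [mul_le_mul_of_nonneg_right hdrift (Real.exp_pos (a * u)).le]
  have hle := hanti (Set.mem_Ici.2 le_rfl) (Set.mem_Ici.2 t.coe_nonneg) t.coe_nonneg
  have hΦ0 : Φ 0 = φ 0 := hΦ 0
  simp only [mul_zero, Real.exp_zero, mul_one, hΦ, hΦ0] at hle
  rw [neg_mul, Real.exp_neg, ← div_eq_mul_inv, ← sub_le_iff_le_add', le_div_iff₀ (Real.exp_pos _)]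
  exact hle

lemma exists_forall_abs_le_of_finite_support {E : Type*} {f : E → ℝ} (hf : f.support.Finite) :
    ∃ B, ∀ x, |f x| ≤ B := by
  obtain ⟨B, hB⟩ := (hf.image fun x => |f x|).bddAbove
  refine ⟨max B 0, fun x => ?_⟩
  by_cases hx : f x = 0
  · simp [hx]
  · exact (hB ⟨x, hx, rfl⟩).trans (le_max_left _ _)

/-! ### Pure jump processes -/

/-- The transition mechanism of a pure jump process on `E` with finitely many kinds of transitions:
the transition `e` takes the state `x` to `next e x` at rate `rate e x`. Each transition changes the
size of the population by at most one, the total rate of the transitions that increase it is at most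
`birthRate`, and the rates grow at most linearly in the size. Such a process cannot explode. -/
structure PopulationDynamics (E ι : Type*) [Fintype ι] where
  size : E → ℕ
  next : ι → E → E
  rate : ι → E → ℝ
  birthRate : ℝ
  rateBound : ℝ
  finite_size_le : ∀ n, {x | size x ≤ n}.Finite
  size_next_le : ∀ e x, size (next e x) ≤ size x + 1
  size_le_size_next : ∀ e x, size x ≤ size (next e x) + 1
  rate_nonneg : ∀ e x, 0 ≤ rate e x
  rate_le : ∀ e x, rate e x ≤ rateBound * (size x + 1)
  sum_rate_birth_le : ∀ x, ∑ e with size x < size (next e x), rate e x ≤ birthRate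

namespace PopulationDynamics

variable {E ι : Type*} [Fintype ι] (D : PopulationDynamics E ι)

/-- The generator of the pure jump process with dynamics `D`. -/
def generator (f : E → ℝ) (x : E) : ℝ := ∑ e, D.rate e x * (f (D.next e x) - f x)

/-- `f` grows at most exponentially in the size of the population. -/
def HasExpGrowth (f : E → ℝ) : Prop :=
  ∃ C θ : ℝ, 0 ≤ C ∧ 1 ≤ θ ∧ ∀ x, |f x| ≤ C * θ ^ D.size x

/-- `S` solves the martingale problem for the generator of `D`, with right-continuous piecewise
constant paths, initial state `x₀` and finitely supported test functions. -/
structure IsChain [MeasurableSpace E] (x₀ : E) {Ω : Type*} [mΩ : MeasurableSpace Ω]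
    (P : Measure Ω) (ℱ : Filtration ℝ≥0 mΩ) (S : ℝ≥0 → Ω → E) : Prop where
  adapted : ∀ t, Measurable[ℱ t] (S t)
  right_cont : ∀ ω t, ∀ᶠ u in 𝓝[≥] t, S u ω = S t ω
  initial : ∀ᵐ ω ∂P, S 0 ω = x₀
  martingale : ∀ f : E → ℝ, f.support.Finite →
    Martingale (fun (t : ℝ≥0) ω =>
      f (S t ω) - ∫ u in (0 : ℝ)..(t : ℝ), D.generator f (S u.toNNReal ω)) ℱ P

variable {D}

lemma finite_support_generator {f : E → ℝ} (hf : f.support.Finite) :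
    (D.generator f).support.Finite := by
  obtain ⟨n, hn⟩ := (hf.image D.size).bddAbove
  have hzero (x : E) (hx : n < D.size x) : f x = 0 := by
    by_contra h
    exact (hn ⟨x, h, rfl⟩).not_gt hx
  refine (D.finite_size_le (n + 1)).subset fun x hx => ?_
  by_contra hlt
  rw [Set.mem_ofPred_eq, not_le] at hlt
  refine hx (Finset.sum_eq_zero fun e _ => ?_)
  have := D.size_le_size_next e x
  rw [hzero _ (by omega), hzero x (by omega), sub_zero, mul_zero]

lemma abs_generator_le {f : E → ℝ} {C θ : ℝ} (hC : 0 ≤ C) (hθ : 1 ≤ θ)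
    (hf : ∀ x, |f x| ≤ C * θ ^ D.size x) (x : E) :
    |D.generator f x| ≤ Fintype.card ι * |D.rateBound| * (2 * C * θ) * (2 * θ) ^ D.size x := by
  have hpow {y : E} (hy : D.size y ≤ D.size x + 1) : |f y| ≤ C * θ * θ ^ D.size x := by
    calc |f y| ≤ C * θ ^ D.size y := hf y
      _ ≤ C * θ ^ (D.size x + 1) := by gcongr
      _ = C * θ * θ ^ D.size x := by ring
  have hrate (e : ι) : |D.rate e x| ≤ |D.rateBound| * 2 ^ D.size x := by
    rw [abs_of_nonneg (D.rate_nonneg e x)]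
    calc D.rate e x ≤ D.rateBound * (D.size x + 1) := D.rate_le e x
      _ ≤ |D.rateBound| * 2 ^ D.size x := by
        gcongr
        · exact le_abs_self _
        · exact_mod_cast Nat.lt_two_pow_self
  calc |D.generator f x| ≤ ∑ e, |D.rate e x * (f (D.next e x) - f x)| :=
        Finset.abs_sum_le_sum_abs _ _
    _ ≤ ∑ _e : ι, |D.rateBound| * 2 ^ D.size x *
          (C * θ * θ ^ D.size x + C * θ * θ ^ D.size x) := by
        gcongr with e
        rw [abs_mul]
        gcongr
        · exact hrate e
        · exact (abs_sub _ _).trans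
            (add_le_add (hpow (D.size_next_le e x)) (hpow (Nat.le_succ _)))
    _ = _ := by rw [Finset.sum_const, Finset.card_univ, nsmul_eq_mul, mul_pow]; ring

lemma generator_sub_const (f : E → ℝ) (c : ℝ) (x : E) :
    D.generator (fun x => f x - c) x = D.generator f x := by
  simp only [generator, sub_sub_sub_cancel_right]

lemma generator_neg (f : E → ℝ) (x : E) : D.generator (fun x => -f x) x = -D.generator f x := by
  simp only [generator, neg_sub_neg, ← Finset.sum_neg_distrib, ← mul_neg, neg_sub]

lemma generator_pow_min_size_le {θ : ℝ} (hθ : 1 ≤ θ) (n : ℕ) (x : E) :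
    D.generator (fun x => θ ^ min (D.size x) n) x ≤
      D.birthRate * (θ - 1) * θ ^ min (D.size x) n := by
  calc D.generator (fun x => θ ^ min (D.size x) n) x
      ≤ ∑ e, if D.size x < D.size (D.next e x)
          then D.rate e x * ((θ - 1) * θ ^ min (D.size x) n) else 0 := by
        refine Finset.sum_le_sum fun e _ => ?_
        split_ifs with hbirth
        · refine mul_le_mul_of_nonneg_left ?_ (D.rate_nonneg e x)
          have : θ ^ min (D.size (D.next e x)) n ≤ θ ^ (min (D.size x) n + 1) :=
            pow_le_pow_right₀ hθ (by have := D.size_next_le e x; omega)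
          rw [pow_succ] at this
          linarith
        · refine mul_nonpos_of_nonneg_of_nonpos (D.rate_nonneg e x) (sub_nonpos.2 ?_)
          exact pow_le_pow_right₀ hθ (by omega)
    _ = (∑ e with D.size x < D.size (D.next e x), D.rate e x) *
          ((θ - 1) * θ ^ min (D.size x) n) := by
        rw [← Finset.sum_filter, Finset.sum_mul]
    _ ≤ D.birthRate * ((θ - 1) * θ ^ min (D.size x) n) := by
        have : 0 ≤ θ - 1 := by linarith
        gcongr
        exact D.sum_rate_birth_le x
    _ = _ := by ring

namespace HasExpGrowth

variable {f g : E → ℝ}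

lemma mono (hg : D.HasExpGrowth g) (h : ∀ x, |f x| ≤ |g x|) : D.HasExpGrowth f := by
  obtain ⟨C, θ, hC, hθ, hle⟩ := hg
  exact ⟨C, θ, hC, hθ, fun x => (h x).trans (hle x)⟩

lemma const (c : ℝ) : D.HasExpGrowth fun _ => c :=
  ⟨|c|, 1, abs_nonneg _, le_rfl, fun x => by simp⟩

lemma pow {θ : ℝ} (hθ : 1 ≤ θ) : D.HasExpGrowth fun x => θ ^ D.size x :=
  ⟨1, θ, zero_le_one, hθ, fun x => by rw [abs_of_nonneg (by positivity), one_mul]⟩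

lemma natCast_of_le_size {N : E → ℕ} (h : ∀ x, N x ≤ D.size x) :
    D.HasExpGrowth fun x => (N x : ℝ) :=
  (pow one_le_two).mono fun x => by
    rw [Nat.abs_cast, abs_of_nonneg (by positivity)]
    exact_mod_cast (h x).trans Nat.lt_two_pow_self.le

lemma exp_natCast_of_le_size {N : E → ℕ} (h : ∀ x, N x ≤ D.size x) (c : ℝ) :
    D.HasExpGrowth fun x => Real.exp (c * N x) :=
  (pow (Real.one_le_exp (abs_nonneg c))).mono fun x => by
    have hN : (N x : ℝ) ≤ D.size x := by exact_mod_cast h x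
    rw [Real.abs_exp, abs_of_nonneg (by positivity), ← Real.exp_nat_mul, Real.exp_le_exp]
    calc c * N x ≤ |c| * D.size x := by gcongr; exact le_abs_self c
      _ = _ := mul_comm _ _

lemma add (hf : D.HasExpGrowth f) (hg : D.HasExpGrowth g) :
    D.HasExpGrowth fun x => f x + g x := by
  obtain ⟨C, θ, hC, hθ, hfle⟩ := hf
  obtain ⟨C', θ', hC', hθ', hgle⟩ := hg
  refine ⟨C + C', max θ θ', add_nonneg hC hC', hθ.trans (le_max_left _ _), fun x => ?_⟩
  calc |f x + g x| ≤ |f x| + |g x| := abs_add_le _ _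
    _ ≤ C * θ ^ D.size x + C' * θ' ^ D.size x := add_le_add (hfle x) (hgle x)
    _ ≤ C * max θ θ' ^ D.size x + C' * max θ θ' ^ D.size x := by
        gcongr
        · exact le_max_left _ _
        · exact le_max_right _ _
    _ = _ := by ring

lemma mul (hf : D.HasExpGrowth f) (hg : D.HasExpGrowth g) :
    D.HasExpGrowth fun x => f x * g x := by
  obtain ⟨C, θ, hC, hθ, hfle⟩ := hf
  obtain ⟨C', θ', hC', hθ', hgle⟩ := hg
  refine ⟨C * C', θ * θ', mul_nonneg hC hC', one_le_mul_of_one_le_of_one_le hθ hθ', fun x => ?_⟩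
  calc |f x * g x| = |f x| * |g x| := abs_mul _ _
    _ ≤ (C * θ ^ D.size x) * (C' * θ' ^ D.size x) :=
        mul_le_mul (hfle x) (hgle x) (abs_nonneg _) (by positivity)
    _ = _ := by rw [mul_pow]; ring

lemma const_mul (hf : D.HasExpGrowth f) (c : ℝ) : D.HasExpGrowth fun x => c * f x :=
  (const c).mul hf

lemma sub (hf : D.HasExpGrowth f) (hg : D.HasExpGrowth g) :
    D.HasExpGrowth fun x => f x - g x :=
  (hf.add (hg.const_mul (-1))).mono fun x => by rw [neg_one_mul, sub_eq_add_neg]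

lemma neg (hf : D.HasExpGrowth f) : D.HasExpGrowth fun x => -f x :=
  hf.mono fun x => (abs_neg (f x)).le

lemma sum {κ : Type*} {f : κ → E → ℝ} (t : Finset κ) (h : ∀ a ∈ t, D.HasExpGrowth (f a)) :
    D.HasExpGrowth fun x => ∑ a ∈ t, f a x := by
  classical
  induction t using Finset.induction_on with
  | empty => simpa using const 0
  | insert a t ha ih =>
    simp only [Finset.sum_insert ha]
    exact (h a (Finset.mem_insert_self _ _)).add
      (ih fun b hb => h b (Finset.mem_insert_of_mem hb))

lemma prod {κ : Type*} {f : κ → E → ℝ} (t : Finset κ) (h : ∀ a ∈ t, D.HasExpGrowth (f a)) :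
    D.HasExpGrowth fun x => ∏ a ∈ t, f a x := by
  classical
  induction t using Finset.induction_on with
  | empty => simpa using const 1
  | insert a t ha ih =>
    simp only [Finset.prod_insert ha]
    exact (h a (Finset.mem_insert_self _ _)).mul
      (ih fun b hb => h b (Finset.mem_insert_of_mem hb))

lemma generator (hf : D.HasExpGrowth f) : D.HasExpGrowth (D.generator f) := by
  obtain ⟨C, θ, hC, hθ, hle⟩ := hf
  exact ⟨_, 2 * θ, by positivity, by linarith, abs_generator_le hC hθ hle⟩

end HasExpGrowth

namespace IsChain

variable [MeasurableSpace E] {x₀ : E} {Ω : Type*} [mΩ : MeasurableSpace Ω] {P : Measure Ω}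
  {ℱ : Filtration ℝ≥0 mΩ} {S : ℝ≥0 → Ω → E} {f : E → ℝ}

lemma integral_initial [IsProbabilityMeasure P] (hS : D.IsChain x₀ P ℱ S) (f : E → ℝ) :
    ∫ ω, f (S 0 ω) ∂P = f x₀ := by
  rw [integral_congr_ae (hS.initial.mono fun ω hω => congrArg f hω)]
  simp

variable [DiscreteMeasurableSpace E]

lemma measurable_comp (hS : D.IsChain x₀ P ℱ S) (f : E → ℝ) (t : ℝ≥0) :
    Measurable fun ω => f (S t ω) :=
  (Measurable.of_discrete (f := f)).comp ((hS.adapted t).mono (ℱ.le t) le_rfl)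

lemma measurable_uncurry (hS : D.IsChain x₀ P ℱ S) (f : E → ℝ) :
    Measurable fun p : ℝ≥0 × Ω => f (S p.1 p.2) :=
  measurable_uncurry_of_continuousWithinAt_Ici (hS.measurable_comp f) fun ω t =>
    tendsto_const_nhds.congr' ((hS.right_cont ω t).mono fun _ hu => congrArg f hu.symm)

lemma measurable_integral [SFinite P] (hS : D.IsChain x₀ P ℱ S) (f : E → ℝ) :
    Measurable fun u : ℝ => ∫ ω, f (S u.toNNReal ω) ∂P :=
  (hS.measurable_uncurry f).stronglyMeasurable.integral_prod_right'.measurable.comp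
    measurable_real_toNNReal

lemma intervalIntegrable_integral_of_abs_le [SFinite P] (hS : D.IsChain x₀ P ℱ S)
    (hf : ∀ t : ℝ≥0, ∃ B, ∀ u ≤ t, |∫ ω, f (S u ω) ∂P| ≤ B) (a b : ℝ) :
    IntervalIntegrable (fun u : ℝ => ∫ ω, f (S u.toNNReal ω) ∂P) volume a b := by
  obtain ⟨B, hB⟩ := hf (max a b).toNNReal
  rw [intervalIntegrable_iff]
  refine Measure.integrableOn_of_bounded (M := B) (by simp [Set.uIoc])
    (hS.measurable_integral f).aestronglyMeasurable ?_
  exact (ae_restrict_mem measurableSet_uIoc).mono fun u hu => hB _ (Real.toNNReal_mono hu.2)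

variable [IsProbabilityMeasure P]

lemma integrable_comp_of_abs_le (hS : D.IsChain x₀ P ℱ S) {B : ℝ} (hB : ∀ x, |f x| ≤ B)
    (t : ℝ≥0) : Integrable (fun ω => f (S t ω)) P :=
  Integrable.of_bound (hS.measurable_comp f t).aestronglyMeasurable B (ae_of_all _ fun _ => hB _)

lemma dynkin_of_finite_support (hS : D.IsChain x₀ P ℱ S) (hf : f.support.Finite) (t : ℝ≥0) :
    ∫ ω, f (S t ω) ∂P =
      f x₀ + ∫ u in (0 : ℝ)..t, ∫ ω, D.generator f (S u.toNNReal ω) ∂P := by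
  obtain ⟨B, hB⟩ := exists_forall_abs_le_of_finite_support hf
  obtain ⟨B', hB'⟩ :=
    exists_forall_abs_le_of_finite_support (finite_support_generator (D := D) hf)
  have hM := hS.martingale f hf
  have hconst := hM.setIntegral_eq (zero_le (a := t)) MeasurableSet.univ
  have h_int : Integrable (fun ω => f (S t ω)) P := hS.integrable_comp_of_abs_le hB t
  have hint_drift : Integrable (fun ω => ∫ u in (0 : ℝ)..t, D.generator f (S u.toNNReal ω)) P :=
    (h_int.sub (hM.integrable t)).congr (ae_of_all _ fun ω => sub_sub_cancel _ _)
  have hint_prod : Integrable (Function.uncurry fun (u : ℝ) ω => D.generator f (S u.toNNReal ω))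
      ((volume.restrict (Set.uIoc 0 (t : ℝ))).prod P) := by
    have : IsFiniteMeasure (volume.restrict (Set.uIoc 0 (t : ℝ))) := ⟨by simp [Set.uIoc]⟩
    have hmeas : Measurable fun p : ℝ × Ω => (p.1.toNNReal, p.2) :=
      (measurable_real_toNNReal.comp measurable_fst).prodMk measurable_snd
    exact Integrable.of_bound
      ((hS.measurable_uncurry (D.generator f)).comp hmeas).aestronglyMeasurable B'
      (ae_of_all _ fun _ => hB' _)
  simp only [setIntegral_univ, NNReal.coe_zero, intervalIntegral.integral_same, sub_zero] at hconst
  rw [integral_sub h_int hint_drift, hS.integral_initial] at hconst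
  rw [intervalIntegral_integral_swap hint_prod, hconst, sub_add_cancel]

lemma continuous_integral_of_dynkin (hS : D.IsChain x₀ P ℱ S)
    (hdynkin : ∀ t : ℝ≥0, ∫ ω, f (S t ω) ∂P =
      f x₀ + ∫ u in (0 : ℝ)..t, ∫ ω, D.generator f (S u.toNNReal ω) ∂P)
    (hbound : ∀ t : ℝ≥0, ∃ B, ∀ u ≤ t, |∫ ω, D.generator f (S u ω) ∂P| ≤ B) :
    Continuous fun t : ℝ≥0 => ∫ ω, f (S t ω) ∂P := by
  simp only [hdynkin]
  exact continuous_const.add ((intervalIntegral.continuous_primitive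
    (hS.intervalIntegrable_integral_of_abs_le hbound) 0).comp NNReal.continuous_coe)

lemma continuous_integral_of_finite_support (hS : D.IsChain x₀ P ℱ S) (hf : f.support.Finite) :
    Continuous fun t : ℝ≥0 => ∫ ω, f (S t ω) ∂P := by
  obtain ⟨B, hB⟩ :=
    exists_forall_abs_le_of_finite_support (finite_support_generator (D := D) hf)
  refine hS.continuous_integral_of_dynkin (hS.dynkin_of_finite_support hf) fun t =>
    ⟨B, fun u _ => ?_⟩
  simpa using norm_integral_le_of_norm_le_const
    (ae_of_all P fun ω => (Real.norm_eq_abs _).trans_le (hB (S u ω)))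

lemma integrable_pow_min_size (hS : D.IsChain x₀ P ℱ S) {θ : ℝ} (hθ : 1 ≤ θ) (n : ℕ) (t : ℝ≥0) :
    Integrable (fun ω => θ ^ min (D.size (S t ω)) n) P := by
  refine hS.integrable_comp_of_abs_le (f := fun x => θ ^ min (D.size x) n) (B := θ ^ n)
    (fun x => ?_) t
  rw [abs_of_nonneg (by positivity)]
  exact pow_le_pow_right₀ hθ (min_le_right _ _)

lemma integral_pow_min_size_le (hS : D.IsChain x₀ P ℱ S) {θ : ℝ} (hθ : 1 ≤ θ) (n : ℕ)
    (t : ℝ≥0) : ∫ ω, θ ^ min (D.size (S t ω)) n ∂P ≤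
      θ ^ min (D.size x₀) n * Real.exp (D.birthRate * (θ - 1) * t) := by
  set f : E → ℝ := fun x => θ ^ min (D.size x) n - θ ^ n
  have hf : f.support.Finite := by
    refine (D.finite_size_le n).subset fun x hx => ?_
    by_contra hn
    exact hx (sub_eq_zero.2 (by rw [min_eq_right (le_of_not_ge hn)]))
  have hintf (t : ℝ≥0) :
      ∫ ω, f (S t ω) ∂P = ∫ ω, θ ^ min (D.size (S t ω)) n ∂P - θ ^ n := by
    rw [integral_sub (hS.integrable_pow_min_size hθ n t) (integrable_const _)]
    simp
  have hdrift (t : ℝ≥0) : ∫ ω, D.generator f (S t ω) ∂P ≤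
      -(D.birthRate * (θ - 1)) * (-θ ^ n - ∫ ω, f (S t ω) ∂P) := by
    obtain ⟨B, hB⟩ :=
      exists_forall_abs_le_of_finite_support (finite_support_generator (D := D) hf)
    have hle : ∫ ω, D.generator f (S t ω) ∂P ≤
        ∫ ω, D.birthRate * (θ - 1) * θ ^ min (D.size (S t ω)) n ∂P :=
      integral_mono (hS.integrable_comp_of_abs_le hB t)
        ((hS.integrable_pow_min_size hθ n t).const_mul _) fun ω =>
        (generator_sub_const _ _ _).trans_le (generator_pow_min_size_le hθ n _)
    rw [integral_const_mul] at hle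
    rw [hintf]
    linarith
  have hgronwall := le_add_mul_exp_of_eq_integral
    (hS.continuous_integral_of_finite_support (finite_support_generator hf))
    (fun t => by rw [hS.integral_initial, ← hS.dynkin_of_finite_support hf]) hdrift t
  rw [hintf, hS.integral_initial, neg_neg] at hgronwall
  simp only [f] at hgronwall
  linarith

lemma lintegral_pow_size_le (hS : D.IsChain x₀ P ℱ S) {θ : ℝ} (hθ : 1 ≤ θ) (t : ℝ≥0) :
    ∫⁻ ω, ENNReal.ofReal (θ ^ D.size (S t ω)) ∂P ≤
      ENNReal.ofReal (θ ^ D.size x₀ * Real.exp (D.birthRate * (θ - 1) * t)) := by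
  have hlim (ω : Ω) : Tendsto (fun n => ENNReal.ofReal (θ ^ min (D.size (S t ω)) n)) atTop
      (𝓝 (ENNReal.ofReal (θ ^ D.size (S t ω)))) :=
    tendsto_const_nhds.congr' ((eventually_ge_atTop (D.size (S t ω))).mono fun n hn => by
      simp only [min_eq_left hn])
  have hmono (ω : Ω) : Monotone fun n => ENNReal.ofReal (θ ^ min (D.size (S t ω)) n) :=
    fun a b hab => ENNReal.ofReal_le_ofReal (pow_le_pow_right₀ hθ (min_le_min_left _ hab))
  refine le_of_tendsto' (lintegral_tendsto_of_tendsto_of_monotone (fun n =>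
    (hS.measurable_comp (fun x => θ ^ min (D.size x) n) t).ennreal_ofReal.aemeasurable)
    (ae_of_all _ hmono) (ae_of_all _ hlim)) fun n => ?_
  rw [← ofReal_integral_eq_lintegral_ofReal (hS.integrable_pow_min_size hθ n t)
    (ae_of_all _ fun ω => by positivity)]
  refine ENNReal.ofReal_le_ofReal ((hS.integral_pow_min_size_le hθ n t).trans ?_)
  gcongr
  exact min_le_left _ _

lemma integrable_pow_size (hS : D.IsChain x₀ P ℱ S) {θ : ℝ} (hθ : 1 ≤ θ) (t : ℝ≥0) :
    Integrable (fun ω => θ ^ D.size (S t ω)) P := by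
  refine ⟨(hS.measurable_comp (fun x => θ ^ D.size x) t).aestronglyMeasurable, ?_⟩
  rw [hasFiniteIntegral_iff_ofReal (ae_of_all _ fun ω => by positivity)]
  exact (hS.lintegral_pow_size_le hθ t).trans_lt ENNReal.ofReal_lt_top

lemma integral_pow_size_le (hS : D.IsChain x₀ P ℱ S) {θ : ℝ} (hθ : 1 ≤ θ) (t : ℝ≥0) :
    ∫ ω, θ ^ D.size (S t ω) ∂P ≤ θ ^ D.size x₀ * Real.exp (D.birthRate * (θ - 1) * t) := by
  rw [integral_eq_lintegral_of_nonneg_ae (ae_of_all _ fun ω => by positivity)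
    (hS.integrable_pow_size hθ t).aestronglyMeasurable]
  exact ENNReal.toReal_le_of_le_ofReal (by positivity) (hS.lintegral_pow_size_le hθ t)

lemma integrable_comp (hS : D.IsChain x₀ P ℱ S) (hf : D.HasExpGrowth f) (t : ℝ≥0) :
    Integrable (fun ω => f (S t ω)) P := by
  obtain ⟨C, θ, -, hθ, hle⟩ := hf
  exact ((hS.integrable_pow_size hθ t).const_mul C).mono'
    (hS.measurable_comp f t).aestronglyMeasurable (ae_of_all _ fun ω => hle _)

lemma exists_forall_abs_integral_le (hS : D.IsChain x₀ P ℱ S) {C θ : ℝ} (hC : 0 ≤ C)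
    (hθ : 1 ≤ θ) (t : ℝ≥0) : ∃ B, ∀ f : E → ℝ, (∀ x, |f x| ≤ C * θ ^ D.size x) →
      ∀ u ≤ t, |∫ ω, f (S u ω) ∂P| ≤ B := by
  refine ⟨C * (θ ^ D.size x₀ * Real.exp (|D.birthRate| * (θ - 1) * t)), fun f hf u hu => ?_⟩
  calc |∫ ω, f (S u ω) ∂P| ≤ ∫ ω, C * θ ^ D.size (S u ω) ∂P :=
        norm_integral_le_of_norm_le ((hS.integrable_pow_size hθ u).const_mul C)
          (ae_of_all _ fun ω => (Real.norm_eq_abs _).trans_le (hf _))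
    _ = C * ∫ ω, θ ^ D.size (S u ω) ∂P := integral_const_mul _ _
    _ ≤ C * (θ ^ D.size x₀ * Real.exp (D.birthRate * (θ - 1) * u)) := by
        gcongr
        exact hS.integral_pow_size_le hθ u
    _ ≤ _ := by
        gcongr
        exact le_abs_self _

lemma tendsto_integral (hS : D.IsChain x₀ P ℱ S) {F : ℕ → E → ℝ} {C θ : ℝ} (hθ : 1 ≤ θ)
    (hF : ∀ n x, |F n x| ≤ C * θ ^ D.size x) (hlim : ∀ x, Tendsto (F · x) atTop (𝓝 (f x)))
    (t : ℝ≥0) : Tendsto (fun n => ∫ ω, F n (S t ω) ∂P) atTop (𝓝 (∫ ω, f (S t ω) ∂P)) :=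
  tendsto_integral_of_dominated_convergence _
    (fun _ => (hS.measurable_comp _ _).aestronglyMeasurable)
    ((hS.integrable_pow_size hθ t).const_mul C) (fun n => ae_of_all _ fun _ => hF n _)
    (ae_of_all _ fun _ => hlim _)

lemma dynkin (hS : D.IsChain x₀ P ℱ S) (hf : D.HasExpGrowth f) (t : ℝ≥0) :
    ∫ ω, f (S t ω) ∂P =
      f x₀ + ∫ u in (0 : ℝ)..t, ∫ ω, D.generator f (S u.toNNReal ω) ∂P := by
  obtain ⟨C, θ, hC, hθ, hle⟩ := hf
  set F : ℕ → E → ℝ := fun n => Set.indicator {x | D.size x ≤ n} f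
  have hF (n : ℕ) : (F n).support.Finite :=
    (D.finite_size_le n).subset fun x hx => Set.mem_of_indicator_ne_zero hx
  have hFle (n : ℕ) (x : E) : |F n x| ≤ C * θ ^ D.size x :=
    (norm_indicator_le_norm_self (s := {x | D.size x ≤ n}) f x).trans (hle x)
  have hFlim (x : E) : Tendsto (fun n => F n x) atTop (𝓝 (f x)) :=
    tendsto_const_nhds.congr' ((eventually_ge_atTop (D.size x)).mono fun n hn =>
      (Set.indicator_of_mem (s := {x | D.size x ≤ n}) hn f).symm)
  have hgen_le (n : ℕ) := abs_generator_le hC hθ (hFle n)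
  have hgen_lim (x : E) : Tendsto (fun n => D.generator (F n) x) atTop (𝓝 (D.generator f x)) :=
    tendsto_finsetSum _ fun e _ => ((hFlim _).sub (hFlim _)).const_mul _
  have hlim_int : Tendsto
      (fun n => ∫ u in (0 : ℝ)..t, ∫ ω, D.generator (F n) (S u.toNNReal ω) ∂P) atTop
      (𝓝 (∫ u in (0 : ℝ)..t, ∫ ω, D.generator f (S u.toNNReal ω) ∂P)) := by
    obtain ⟨B, hB⟩ := hS.exists_forall_abs_integral_le (C := Fintype.card ι * |D.rateBound| *
      (2 * C * θ)) (θ := 2 * θ) (by positivity) (by linarith) t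
    refine intervalIntegral.tendsto_integral_filter_of_dominated_convergence (fun _ => B)
      (.of_forall fun n => (hS.measurable_integral _).aestronglyMeasurable)
      (.of_forall fun n => ae_of_all _ fun u hu => hB _ (hgen_le n) _ ?_)
      intervalIntegrable_const (ae_of_all _ fun u _ =>
        hS.tendsto_integral (by linarith) hgen_le hgen_lim _)
    rw [Set.uIoc_of_le t.coe_nonneg] at hu
    exact Real.toNNReal_le_iff_le_coe.2 hu.2
  refine tendsto_nhds_unique (hS.tendsto_integral hθ hFle hFlim t)
    (((hFlim x₀).add hlim_int).congr fun n => ?_)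
  exact (hS.dynkin_of_finite_support (hF n) t).symm

lemma continuous_integral (hS : D.IsChain x₀ P ℱ S) (hf : D.HasExpGrowth f) :
    Continuous fun t : ℝ≥0 => ∫ ω, f (S t ω) ∂P := by
  obtain ⟨C, θ, hC, hθ, hle⟩ := hf.generator
  refine hS.continuous_integral_of_dynkin (hS.dynkin hf) fun t => ?_
  exact (hS.exists_forall_abs_integral_le hC hθ t).imp fun B hB => hB _ hle

lemma integral_le_of_drift (hS : D.IsChain x₀ P ℱ S) {g : E → ℝ} (hf : D.HasExpGrowth f)
    (hg : D.HasExpGrowth g) {a K : ℝ} (hdrift : ∀ x, D.generator f x ≤ g x - a * f x)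
    (hK : ∀ t, ∫ ω, g (S t ω) ∂P ≤ a * K) (t : ℝ≥0) :
    ∫ ω, f (S t ω) ∂P ≤ K + (f x₀ - K) * Real.exp (-a * t) := by
  rw [← hS.integral_initial f]
  refine le_add_mul_exp_of_eq_integral (φ := fun t => ∫ ω, f (S t ω) ∂P)
    (hS.continuous_integral hf.generator)
    (fun t => by simp only [hS.integral_initial, hS.dynkin hf t]) (fun t => ?_) t
  calc ∫ ω, D.generator f (S t ω) ∂P
      ≤ ∫ ω, (g (S t ω) - a * f (S t ω)) ∂P :=
        integral_mono (hS.integrable_comp hf.generator t)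
          (hS.integrable_comp (hg.sub (hf.const_mul a)) t) fun ω => hdrift _
    _ = ∫ ω, g (S t ω) ∂P - a * ∫ ω, f (S t ω) ∂P := by
        rw [integral_sub (hS.integrable_comp hg t) (hS.integrable_comp (hf.const_mul a) t),
          integral_const_mul]
    _ ≤ a * (K - ∫ ω, f (S t ω) ∂P) := by linarith [hK t]

lemma integral_eq_of_drift (hS : D.IsChain x₀ P ℱ S) (hf : D.HasExpGrowth f) {a K : ℝ}
    (hdrift : ∀ x, D.generator f x = a * K - a * f x) (t : ℝ≥0) :
    ∫ ω, f (S t ω) ∂P = K + (f x₀ - K) * Real.exp (-a * t) := by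
  refine le_antisymm (hS.integral_le_of_drift hf (.const (a * K)) (fun x => (hdrift x).le)
    (fun _ => by simp) t) ?_
  have hneg := hS.integral_le_of_drift hf.neg (.const (a * -K)) (a := a) (K := -K)
    (fun x => by rw [generator_neg, hdrift]; linarith) (fun _ => by simp) t
  rw [integral_neg] at hneg
  linarith

lemma integral_le_of_drift_of_initial_le (hS : D.IsChain x₀ P ℱ S) {g : E → ℝ}
    (hf : D.HasExpGrowth f) (hg : D.HasExpGrowth g) {a K : ℝ}
    (hdrift : ∀ x, D.generator f x ≤ g x - a * f x) (hK : ∀ t, ∫ ω, g (S t ω) ∂P ≤ a * K)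
    (h₀ : f x₀ ≤ K) (t : ℝ≥0) : ∫ ω, f (S t ω) ∂P ≤ K :=
  (hS.integral_le_of_drift hf hg hdrift hK t).trans <| add_le_of_nonpos_right <|
    mul_nonpos_of_nonpos_of_nonneg (sub_nonpos.2 h₀) (Real.exp_pos _).le

end IsChain

end PopulationDynamics

namespace LossNetwork

variable {m s : ℕ} {L : LossNetwork m s}

namespace State

variable (st : L.State) (i : Fin m) (j : Fin (L.numAlloc i))

@[simp]
lemma addReq_fst_self : (st.addReq i j).1 i = Function.update (st.1 i) j (st.1 i j + 1) :=
  Function.update_self ..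

@[simp]
lemma removeReq_fst_self : (st.removeReq i j).1 i = Function.update (st.1 i) j (st.1 i j - 1) :=
  Function.update_self ..

@[simp]
lemma addFict_snd_self : (st.addFict i).2 i = st.2 i + 1 :=
  Function.update_self ..

@[simp]
lemma removeFict_snd_self : (st.removeFict i).2 i = st.2 i - 1 :=
  Function.update_self ..

@[simp]
lemma addReq_snd : (st.addReq i j).2 = st.2 := rfl

@[simp]
lemma removeReq_snd : (st.removeReq i j).2 = st.2 := rfl

@[simp]
lemma addFict_fst : (st.addFict i).1 = st.1 := rfl

@[simp]
lemma removeFict_fst : (st.removeFict i).1 = st.1 := rfl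

end State

/-- The function `f` of the state depends on the requests of class `i` only. -/
def DependsOnClass {γ : Type*} (i : Fin m) (f : L.State → γ) : Prop :=
  ∀ ⦃st st' : L.State⦄, st.1 i = st'.1 i → st.2 i = st'.2 i → f st = f st'

namespace DependsOnClass

variable {γ : Type*} {i i' : Fin m} {f : L.State → γ}

lemma addReq_of_ne (hf : DependsOnClass i f) (h : i' ≠ i) (st : L.State)
    (j : Fin (L.numAlloc i')) : f (st.addReq i' j) = f st :=
  hf (Function.update_of_ne h.symm ..) rfl

lemma removeReq_of_ne (hf : DependsOnClass i f) (h : i' ≠ i) (st : L.State)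
    (j : Fin (L.numAlloc i')) : f (st.removeReq i' j) = f st :=
  hf (Function.update_of_ne h.symm ..) rfl

lemma addFict_of_ne (hf : DependsOnClass i f) (h : i' ≠ i) (st : L.State) :
    f (st.addFict i') = f st :=
  hf rfl (Function.update_of_ne h.symm ..)

lemma removeFict_of_ne (hf : DependsOnClass i f) (h : i' ≠ i) (st : L.State) :
    f (st.removeFict i') = f st :=
  hf rfl (Function.update_of_ne h.symm ..)

lemma afterArrival_of_ne (hf : DependsOnClass i f) (h : i' ≠ i) (d : L.Rule) (st : L.State) :
    f (L.afterArrival d i' st) = f st := by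
  unfold afterArrival
  split
  · exact hf.addReq_of_ne h st _
  · exact hf.addFict_of_ne h st

lemma generator_eq {f : L.State → ℝ} (hf : DependsOnClass i f) (d : L.Rule) (st : L.State) :
    L.generator d f st = L.arrivalRate i * (f (L.afterArrival d i st) - f st)
      + ∑ j, L.serviceRate i * (st.1 i j : ℝ) * (f (st.removeReq i j) - f st)
      + L.serviceRate i * (st.2 i : ℝ) * (f (st.removeFict i) - f st) := by
  unfold generator
  congr 1
  · congr 1
    · refine Finset.sum_eq_single_of_mem i (Finset.mem_univ i) fun i' _ hi' => ?_
      rw [hf.afterArrival_of_ne hi', sub_self, mul_zero]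
    · refine Finset.sum_eq_single_of_mem i (Finset.mem_univ i) fun i' _ hi' => ?_
      exact Finset.sum_eq_zero fun j _ => by rw [hf.removeReq_of_ne hi', sub_self, mul_zero]
  · refine Finset.sum_eq_single_of_mem i (Finset.mem_univ i) fun i' _ hi' => ?_
    rw [hf.removeFict_of_ne hi', sub_self, mul_zero]

end DependsOnClass

lemma afterArrival_of_eq_some {d : L.Rule} {i : Fin m} {st : L.State} {j : Fin (L.numAlloc i)}
    (h : d i st = some j) : L.afterArrival d i st = st.addReq i j := by
  simp only [afterArrival, h]

lemma afterArrival_of_eq_none {d : L.Rule} {i : Fin m} {st : L.State} (h : d i st = none) :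
    L.afterArrival d i st = st.addFict i := by
  simp only [afterArrival, h]

namespace State

/-- The number of class `i` requests, in the network or in the fictitious system. -/
def classTotal (i : Fin m) (st : L.State) : ℕ := (∑ j, st.1 i j) + st.2 i

/-- The number of all requests, in the network or in the fictitious system. It bounds every
component of the state, so that it can measure the growth of functions of the state. -/
def total (st : L.State) : ℕ := ∑ i, st.classTotal i

variable (st : L.State) (i : Fin m)

lemma dependsOnClass_classTotal : DependsOnClass (L := L) i (classTotal i) :=
  fun _ _ h₁ h₂ => by rw [classTotal, classTotal, h₁, h₂]

omit st i in
lemma sum_update_add {κ : Type*} [Fintype κ] [DecidableEq κ] (x : κ → ℕ) (j : κ) (n : ℕ) :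
    ∑ a, Function.update x j n a + x j = ∑ a, x a + n := by
  rw [Finset.sum_update_of_mem (Finset.mem_univ j),
    ← Finset.add_sum_erase _ x (Finset.mem_univ j), Finset.sdiff_singleton_eq_erase]
  ring

@[simp]
lemma classTotal_addReq_self (j : Fin (L.numAlloc i)) :
    (st.addReq i j).classTotal i = st.classTotal i + 1 := by
  have := sum_update_add (st.1 i) j (st.1 i j + 1)
  simp only [classTotal, addReq_fst_self, addReq_snd]
  lia

@[simp]
lemma classTotal_addFict_self : (st.addFict i).classTotal i = st.classTotal i + 1 := by
  simp only [classTotal, addFict_fst, addFict_snd_self]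
  lia

lemma classTotal_removeReq_self_add (j : Fin (L.numAlloc i)) :
    (st.removeReq i j).classTotal i + st.1 i j = st.classTotal i + (st.1 i j - 1) := by
  have := sum_update_add (st.1 i) j (st.1 i j - 1)
  simp only [classTotal, removeReq_fst_self, removeReq_snd]
  lia

lemma classTotal_removeFict_self_add :
    (st.removeFict i).classTotal i + st.2 i = st.classTotal i + (st.2 i - 1) := by
  simp only [classTotal, removeFict_fst, removeFict_snd_self]
  lia

lemma classTotal_afterArrival_self (d : L.Rule) :
    (L.afterArrival d i st).classTotal i = st.classTotal i + 1 := by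
  unfold afterArrival
  split
  · exact st.classTotal_addReq_self i _
  · exact st.classTotal_addFict_self i

variable {st i} in
lemma total_add_classTotal {st' : L.State}
    (h : ∀ i', i' ≠ i → st'.classTotal i' = st.classTotal i') :
    st'.total + st.classTotal i = st.total + st'.classTotal i := by
  have hsum : ∑ i' ∈ Finset.univ.erase i, st'.classTotal i' =
      ∑ i' ∈ Finset.univ.erase i, st.classTotal i' :=
    Finset.sum_congr rfl fun i' hi' => h i' (Finset.ne_of_mem_erase hi')
  unfold total
  rw [← Finset.add_sum_erase _ (classTotal · st) (Finset.mem_univ i),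
    ← Finset.add_sum_erase _ (classTotal · st') (Finset.mem_univ i), hsum]
  ring

lemma total_afterArrival (d : L.Rule) : (L.afterArrival d i st).total = st.total + 1 := by
  have h := total_add_classTotal fun i' (hi' : i' ≠ i) =>
    (dependsOnClass_classTotal i').afterArrival_of_ne hi'.symm d st
  have := st.classTotal_afterArrival_self i d
  lia

lemma total_removeReq_add (j : Fin (L.numAlloc i)) :
    (st.removeReq i j).total + st.1 i j = st.total + (st.1 i j - 1) := by
  have h := total_add_classTotal fun i' (hi' : i' ≠ i) =>
    (dependsOnClass_classTotal i').removeReq_of_ne hi'.symm st j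
  have := st.classTotal_removeReq_self_add i j
  lia

lemma total_removeFict_add :
    (st.removeFict i).total + st.2 i = st.total + (st.2 i - 1) := by
  have h := total_add_classTotal fun i' (hi' : i' ≠ i) =>
    (dependsOnClass_classTotal i').removeFict_of_ne hi'.symm st
  have := st.classTotal_removeFict_self_add i
  lia

lemma classTotal_le_total : st.classTotal i ≤ st.total :=
  Finset.single_le_sum (f := (classTotal · st)) (fun _ _ => Nat.zero_le _) (Finset.mem_univ i)

lemma fst_le_total (j : Fin (L.numAlloc i)) : st.1 i j ≤ st.total :=
  ((Finset.single_le_sum (fun _ _ => Nat.zero_le _) (Finset.mem_univ j)).trans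
    (Nat.le_add_right _ _)).trans (st.classTotal_le_total i)

lemma snd_le_total : st.2 i ≤ st.total :=
  (Nat.le_add_left _ _).trans (st.classTotal_le_total i)

omit st i in
lemma finite_setOf_total_le (n : ℕ) : {st : L.State | st.total ≤ n}.Finite := by
  classical
  exact (Set.finite_Icc (0 : L.State) (fun _ _ => n, fun _ => n)).subset fun st hst =>
    ⟨⟨fun _ _ => Nat.zero_le _, fun _ => Nat.zero_le _⟩,
      ⟨fun i j => (st.fst_le_total i j).trans hst, fun i => (st.snd_le_total i).trans hst⟩⟩

end State

lemma natCast_mul_sub_eq_neg {a b n : ℕ} (h : a + n = b + (n - 1)) :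
    (n : ℝ) * ((a : ℝ) - b) = -n := by
  rcases Nat.eq_zero_or_pos n with rfl | hn
  · simp
  · obtain rfl : b = a + 1 := by lia
    push_cast
    ring

lemma generator_classTotal (d : L.Rule) (i : Fin m) (st : L.State) :
    L.generator d (fun st => (st.classTotal i : ℝ)) st =
      L.arrivalRate i - L.serviceRate i * st.classTotal i := by
  have hdep : DependsOnClass (L := L) i fun st => (st.classTotal i : ℝ) :=
    fun _ _ h₁ h₂ => congrArg Nat.cast (State.dependsOnClass_classTotal i h₁ h₂)
  simp only [hdep.generator_eq, st.classTotal_afterArrival_self, mul_assoc,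
    natCast_mul_sub_eq_neg (st.classTotal_removeReq_self_add i _),
    natCast_mul_sub_eq_neg (st.classTotal_removeFict_self_add i)]
  simp only [State.classTotal, ← Finset.mul_sum, Finset.sum_neg_distrib]
  push_cast
  ring

/-! ### The augmented network as a jump process -/

variable (L) in
/-- The transitions of the augmented network: arrivals of class `i`, departures of class `i`
requests with allocation `j` from the network, departures from the fictitious system. -/
abbrev Transition : Type := Fin m ⊕ (Σ i, Fin (L.numAlloc i)) ⊕ Fin m

/-- The state after a transition. -/
def Transition.next (d : L.Rule) : L.Transition → L.State → L.State
  | .inl i => L.afterArrival d i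
  | .inr (.inl p) => fun st => st.removeReq p.1 p.2
  | .inr (.inr i) => fun st => st.removeFict i

/-- The rate of a transition. -/
def Transition.rate : L.Transition → L.State → ℝ
  | .inl i => fun _ => L.arrivalRate i
  | .inr (.inl p) => fun st => L.serviceRate p.1 * (st.1 p.1 p.2 : ℝ)
  | .inr (.inr i) => fun st => L.serviceRate i * (st.2 i : ℝ)

lemma Transition.rate_nonneg (e : L.Transition) (st : L.State) : 0 ≤ e.rate st := by
  rcases e with i | p | i
  · exact (L.arrivalRate_pos i).le
  · exact mul_nonneg (L.serviceRate_pos p.1).le (Nat.cast_nonneg _)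
  · exact mul_nonneg (L.serviceRate_pos i).le (Nat.cast_nonneg _)

lemma Transition.rate_le (e : L.Transition) (st : L.State) :
    e.rate st ≤ (∑ i, L.arrivalRate i + ∑ i, L.serviceRate i) * (st.total + 1) := by
  have harr (i : Fin m) : L.arrivalRate i ≤ ∑ i, L.arrivalRate i :=
    Finset.single_le_sum (fun i _ => (L.arrivalRate_pos i).le) (Finset.mem_univ i)
  have hserv (i : Fin m) : L.serviceRate i ≤ ∑ i, L.serviceRate i :=
    Finset.single_le_sum (fun i _ => (L.serviceRate_pos i).le) (Finset.mem_univ i)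
  have harr₀ : 0 ≤ ∑ i, L.arrivalRate i := Finset.sum_nonneg fun i _ => (L.arrivalRate_pos i).le
  have hserv₀ : 0 ≤ ∑ i, L.serviceRate i := Finset.sum_nonneg fun i _ => (L.serviceRate_pos i).le
  have hdep {n : ℕ} (hn : n ≤ st.total) (i : Fin m) : L.serviceRate i * n ≤
      (∑ i, L.arrivalRate i + ∑ i, L.serviceRate i) * (st.total + 1) := by
    refine mul_le_mul ((hserv i).trans (le_add_of_nonneg_left harr₀)) ?_ (Nat.cast_nonneg _)
      (add_nonneg harr₀ hserv₀)
    exact_mod_cast hn.trans (Nat.le_succ _)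
  rcases e with i | p | i
  · calc L.arrivalRate i ≤ ∑ i, L.arrivalRate i + ∑ i, L.serviceRate i :=
          (harr i).trans (le_add_of_nonneg_right hserv₀)
      _ ≤ _ := le_mul_of_one_le_right (add_nonneg harr₀ hserv₀) (by simp)
  · exact hdep (st.fst_le_total p.1 p.2) p.1
  · exact hdep (st.snd_le_total i) i

lemma Transition.total_next_le_and_le_total_next (d : L.Rule) (e : L.Transition) (st : L.State) :
    (e.next d st).total ≤ st.total + 1 ∧ st.total ≤ (e.next d st).total + 1 := by
  rcases e with i | p | i <;> dsimp only [Transition.next]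
  · have := st.total_afterArrival i d
    lia
  · have := st.total_removeReq_add p.1 p.2
    lia
  · have := st.total_removeFict_add i
    lia

lemma Transition.sum_rate_birth_le (d : L.Rule) (st : L.State) :
    ∑ e : L.Transition with st.total < (e.next d st).total, e.rate st ≤ ∑ i, L.arrivalRate i := by
  have hreq (p : Σ i, Fin (L.numAlloc i)) : (st.removeReq p.1 p.2).total ≤ st.total := by
    have := st.total_removeReq_add p.1 p.2
    lia
  have hfict (i : Fin m) : (st.removeFict i).total ≤ st.total := by
    have := st.total_removeFict_add i
    lia
  rw [Finset.sum_filter, Fintype.sum_sum_type, Fintype.sum_sum_type]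
  simp [Transition.next, Transition.rate, st.total_afterArrival, (hreq _).not_gt,
    (hfict _).not_gt]

variable (L) in
/-- The augmented network under the rule `d` as a pure jump process. -/
def dynamics (d : L.Rule) : PopulationDynamics L.State L.Transition where
  size := State.total
  next := Transition.next d
  rate := Transition.rate
  birthRate := ∑ i, L.arrivalRate i
  rateBound := ∑ i, L.arrivalRate i + ∑ i, L.serviceRate i
  finite_size_le := State.finite_setOf_total_le
  size_next_le := fun e st => (e.total_next_le_and_le_total_next d st).1
  size_le_size_next := fun e st => (e.total_next_le_and_le_total_next d st).2
  rate_nonneg := Transition.rate_nonneg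
  rate_le := Transition.rate_le
  sum_rate_birth_le := Transition.sum_rate_birth_le d

lemma generator_dynamics (d : L.Rule) (f : L.State → ℝ) :
    (L.dynamics d).generator f = L.generator d f := by
  funext st
  simp only [PopulationDynamics.generator, generator, dynamics, Fintype.sum_sum_type,
    Fintype.sum_sigma, Transition.next, Transition.rate, add_assoc]

lemma IsStateChain.isChain {d : L.Rule} {y₀ : Fin m → ℕ} {Ω : Type*} [mΩ : MeasurableSpace Ω]
    {P : Measure Ω} {ℱ : Filtration ℝ≥0 mΩ} {S : ℝ≥0 → Ω → L.State}
    (hS : L.IsStateChain d y₀ P ℱ S) :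
    (L.dynamics d).IsChain ((fun _ _ => 0, y₀) : L.State) P ℱ S where
  adapted := hS.adapted
  right_cont := hS.right_cont
  initial := hS.initial
  martingale := by simpa only [generator_dynamics] using hS.martingale

end LossNetwork

lemma sum_update_mul {κ R : Type*} [Fintype κ] [DecidableEq κ] [CommRing R] (x w : κ → R) (j : κ)
    (u : R) : ∑ a, Function.update x j u a * w a = ∑ a, x a * w a + (u - x j) * w j := by
  have hupd (a : κ) : Function.update x j u a * w a =
      Function.update (fun a => x a * w a) j (u * w j) a :=
    (Function.apply_update (fun a y => y * w a) x j u a)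
  simp only [hupd]
  rw [Finset.sum_update_of_mem (Finset.mem_univ j), Finset.sdiff_singleton_eq_erase,
    ← Finset.add_sum_erase _ (fun a => x a * w a) (Finset.mem_univ j)]
  ring

lemma exp_sub_one_le_mul {ε h : ℝ} (h₀ : 0 ≤ h) (hh : h ≤ ε) (hε : ε ≤ 1) :
    Real.exp h - 1 ≤ (1 + ε) * h := by
  have hexp := (abs_le.1 (Real.abs_exp_sub_one_sub_id_le (x := h)
    (by rw [abs_of_nonneg h₀]; linarith))).2
  nlinarith

lemma exp_neg_sub_one_le_mul {ε h : ℝ} (h₀ : 0 ≤ h) (hh : h ≤ ε) :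
    Real.exp (-h) - 1 ≤ -((1 - ε / 2) * h) := by
  have hquad : Real.exp (-h) ≤ 1 - h + h ^ 2 / 2 := by
    rw [Real.exp_neg, inv_le_iff_one_le_mul₀ (Real.exp_pos h)]
    have hnonneg : 0 ≤ 1 - h + h ^ 2 / 2 := by nlinarith [sq_nonneg (h - 1)]
    nlinarith [mul_le_mul_of_nonneg_left (Real.quadratic_le_exp_of_nonneg h₀) hnonneg,
      sq_nonneg (h ^ 2)]
  nlinarith

lemma mul_log_add_sub_le_mul_log {x A : ℝ} (hx : 0 < x) (hA : 0 < A) :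
    x * Real.log A + x - A ≤ x * Real.log x := by
  have hlog := Real.log_le_sub_one_of_pos (div_pos hA hx)
  rw [Real.log_div hA.ne' hx.ne'] at hlog
  have hmul := mul_le_mul_of_nonneg_left hlog hx.le
  have hx' : x * (A / x - 1) = A - x := by field_simp
  linarith

lemma le_two_mul_rpow_mul_rpow {a m F Y : ℝ} (ha : 0 < a) (ha₁ : a ≤ 1) (hm : 0 ≤ m)
    (hF : m * a ≤ F) (hY₀ : 0 ≤ Y) (hY : m * (1 - a) ≤ Y) :
    m ≤ 2 * (F ^ a * Y ^ (1 - a)) := by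
  have hF₀ : 0 ≤ F := (mul_nonneg hm ha.le).trans hF
  rcases ha₁.eq_or_lt with rfl | ha₁
  · simp only [sub_self, Real.rpow_one, Real.rpow_zero]
    linarith
  have hb : 0 < 1 - a := sub_pos.2 ha₁
  have hrpow {c G : ℝ} (hc : 0 < c) (hG : 0 ≤ G) (h : m * c ≤ G) : m ^ c ≤ c⁻¹ ^ c * G ^ c := by
    rw [← Real.mul_rpow (by positivity) hG]
    exact Real.rpow_le_rpow hm ((le_inv_mul_iff₀' hc).2 h) hc.le
  have hamgm : a⁻¹ ^ a * (1 - a)⁻¹ ^ (1 - a) ≤ 2 := by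
    refine (Real.geom_mean_le_arith_mean2_weighted ha.le hb.le (inv_nonneg.2 ha.le)
      (inv_nonneg.2 hb.le) (by ring)).trans_eq ?_
    rw [mul_inv_cancel₀ ha.ne', mul_inv_cancel₀ hb.ne']
    norm_num
  calc m = m ^ a * m ^ (1 - a) := by
        rw [← Real.rpow_add_of_nonneg hm ha.le hb.le, add_sub_cancel, Real.rpow_one]
    _ ≤ (a⁻¹ ^ a * F ^ a) * ((1 - a)⁻¹ ^ (1 - a) * Y ^ (1 - a)) :=
        mul_le_mul (hrpow ha hF₀ hF) (hrpow hb hY₀ hY) (by positivity) (by positivity)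
    _ = (a⁻¹ ^ a * (1 - a)⁻¹ ^ (1 - a)) * (F ^ a * Y ^ (1 - a)) := by ring
    _ ≤ 2 * (F ^ a * Y ^ (1 - a)) := mul_le_mul_of_nonneg_right hamgm (by positivity)

lemma rpow_le_of_le_mul_one_add {F F' p a : ℝ} (hF' : 0 ≤ F') (hF : 0 ≤ F)
    (h : F' ≤ F * (1 + p)) (hp : -1 ≤ p) (ha : 0 ≤ a) (ha₁ : a ≤ 1) :
    F' ^ a ≤ F ^ a * (1 + a * p) := by
  calc F' ^ a ≤ (F * (1 + p)) ^ a := Real.rpow_le_rpow hF' h ha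
    _ = F ^ a * (1 + p) ^ a := Real.mul_rpow hF (by linarith)
    _ ≤ F ^ a * (1 + a * p) := by
        gcongr
        exact rpow_one_add_le_one_add_mul_self hp ha ha₁

namespace LossNetwork

variable {m s : ℕ} {L : LossNetwork m s}

/-! ### Penalties -/

/-- The total fraction of class `i` requests that are to be admitted, the paper's `α_i`. -/
def accFrac (α : L.Fractions) (i : Fin m) : ℝ := ∑ j, α i j

variable (L) in
/-- The increment of the exponent of the penalty of class `i` at resource `k` caused by one more
request at allocation `j`. -/
def resWeight (ε : ℝ) (α : L.Fractions) (β : ℝ) (i : Fin m) (j : Fin (L.numAlloc i))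
    (k : Fin s) : ℝ :=
  β * (L.alloc i j k / L.resCapacity ε α i k)

variable (L) in
/-- The increment of the exponent of the penalty in the fictitious system caused by one more
request of class `i`. It is `0` if `fictCapacity i = 0`. -/
def fictWeight (ε : ℝ) (α : L.Fractions) (β : ℝ) (i : Fin m) : ℝ := β / L.fictCapacity ε α i

variable (L) in
/-- The exponent of the penalty of class `i` at resource `k`. -/
def resExponent (ε : ℝ) (α : L.Fractions) (β : ℝ) (i : Fin m) (k : Fin s)
    (x : Fin (L.numAlloc i) → ℕ) : ℝ :=
  ∑ j, (x j : ℝ) * L.resWeight ε α β i j k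

variable (L) in
/-- The increment of the exponent of a penalty with capacity `(1 + 4 ε) load i` caused by one more
request. The penalties of class `i` are compared with this value. -/
def loadWeight (ε β : ℝ) (i : Fin m) : ℝ := β / ((1 + 4 * ε) * L.load i)

variable {ε β : ℝ} {α : L.Fractions}

lemma resPenalty_update (i : Fin m) (k : Fin s) (x : Fin (L.numAlloc i) → ℕ)
    (j : Fin (L.numAlloc i)) (u : ℝ) :
    L.resPenalty ε α β i k (Function.update (fun a => (x a : ℝ)) j u) =
      Real.exp (L.resExponent ε α β i k x + (u - x j) * L.resWeight ε α β i j k) := by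
  rw [resPenalty, sum_update_mul, resExponent]
  congr 1
  simp only [resWeight, add_div, mul_add, Finset.sum_div, Finset.mul_sum]
  congr 1
  · exact Finset.sum_congr rfl fun a _ => by ring
  · ring

lemma deriv_fictPenalty (i : Fin m) (y : ℝ) : deriv (L.fictPenalty ε α β i) y =
    L.fictWeight ε α β i * Real.exp (L.fictWeight ε α β i * y) := by
  have hpenalty : L.fictPenalty ε α β i = fun y => Real.exp (L.fictWeight ε α β i * y) :=
    funext fun y => by rw [fictPenalty, fictWeight, mul_div_assoc', div_mul_eq_mul_div]
  have hderiv := ((hasDerivAt_id y).const_mul (L.fictWeight ε α β i)).exp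
  rw [hpenalty]
  refine hderiv.deriv.trans ?_
  simp [mul_comm]

lemma load_pos (i : Fin m) : 0 < L.load i := div_pos (L.arrivalRate_pos i) (L.serviceRate_pos i)

lemma sum_usage_eq (k : Fin s) : ∑ i, ∑ j, α i j * L.load i * L.alloc i j k =
    ∑ i, (∑ j, α i j * L.alloc i j k) * L.load i := by
  simp only [Finset.sum_mul, mul_right_comm]

lemma sum_resCapacity (k : Fin s) : ∑ i, L.resCapacity ε α i k =
    (1 + 4 * ε) * (L.slack ε α k * ∑ i, ∑ j, α i j * L.load i * L.alloc i j k) := by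
  rw [sum_usage_eq, ← mul_assoc, Finset.mul_sum]
  simp only [resCapacity, mul_assoc]

lemma fictCapacity_eq (i : Fin m) :
    L.fictCapacity ε α i = (1 + 4 * ε) * (1 - accFrac α i) * L.load i := rfl

lemma fictCapacity_eq_zero_iff (hε : 0 < ε) (i : Fin m) :
    L.fictCapacity ε α i = 0 ↔ 1 - accFrac α i = 0 := by
  have hq : 1 + 4 * ε ≠ 0 := by positivity
  simp only [fictCapacity_eq, mul_eq_zero, hq, (load_pos i).ne', false_or, or_false]

lemma one_sub_mul_fictWeight (hε : 0 < ε) (i : Fin m) (h : L.fictCapacity ε α i ≠ 0) :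
    (1 - accFrac α i) * L.fictWeight ε α β i = L.loadWeight ε β i := by
  have hfrac : 1 - accFrac α i ≠ 0 := (fictCapacity_eq_zero_iff hε i).not.1 h
  have hload := (load_pos (L := L) i).ne'
  have hq : 1 + 4 * ε ≠ 0 := by positivity
  rw [fictWeight, fictCapacity_eq, loadWeight]
  field_simp

lemma loadWeight_pos (hε : 0 < ε) (hβ : 0 < β) (i : Fin m) : 0 < L.loadWeight ε β i :=
  div_pos hβ (mul_pos (by positivity) (load_pos i))

lemma one_sub_mul_fictWeight_le (hε : 0 < ε) (hβ : 0 < β) (i : Fin m) :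
    (1 - accFrac α i) * L.fictWeight ε α β i ≤ L.loadWeight ε β i := by
  by_cases h : L.fictCapacity ε α i = 0
  · rw [(fictCapacity_eq_zero_iff hε i).1 h, zero_mul]
    exact (loadWeight_pos hε hβ i).le
  · exact (one_sub_mul_fictWeight hε i h).le

namespace IsFeasible

lemma accFrac_le_one (hα : L.IsFeasible ε α) (i : Fin m) : accFrac α i ≤ 1 := hα.sum_le_one i

lemma accFrac_nonneg (hα : L.IsFeasible ε α) (i : Fin m) : 0 ≤ accFrac α i :=
  Finset.sum_nonneg fun j _ => hα.nonneg i j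

lemma usage_nonneg (hα : L.IsFeasible ε α) (i : Fin m) (k : Fin s) :
    0 ≤ ∑ j, α i j * L.alloc i j k :=
  Finset.sum_nonneg fun j _ => mul_nonneg (hα.nonneg i j) (L.alloc_nonneg i j k)

lemma sum_usage_le (hα : L.IsFeasible ε α) (k : Fin s) :
    ∑ i, ∑ j, α i j * L.load i * L.alloc i j k ≤ 1 / (1 + 4 * ε) * L.capacity k := by
  refine le_of_eq_of_le ?_ (hα.capacity_le k)
  simp only [Finset.mul_sum]
  exact Finset.sum_congr rfl fun i _ => Finset.sum_congr rfl fun j _ => by ring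

lemma sum_usage_nonneg (hα : L.IsFeasible ε α) (k : Fin s) :
    0 ≤ ∑ i, ∑ j, α i j * L.load i * L.alloc i j k := by
  rw [sum_usage_eq]
  exact Finset.sum_nonneg fun i _ => mul_nonneg (hα.usage_nonneg i k) (load_pos i).le

lemma slack_nonneg (hα : L.IsFeasible ε α) (hε : 0 < ε) (k : Fin s) : 0 ≤ L.slack ε α k :=
  div_nonneg (mul_nonneg (by positivity) (L.capacity_nonneg k)) (hα.sum_usage_nonneg k)

lemma resCapacity_nonneg (hα : L.IsFeasible ε α) (hε : 0 < ε) (i : Fin m) (k : Fin s) :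
    0 ≤ L.resCapacity ε α i k :=
  mul_nonneg (mul_nonneg (mul_nonneg (by positivity) (hα.slack_nonneg hε k))
    (hα.usage_nonneg i k)) (load_pos i).le

lemma sum_usage_pos_of_resCapacity_pos (hα : L.IsFeasible ε α) {i : Fin m} {k : Fin s}
    (h : 0 < L.resCapacity ε α i k) : 0 < ∑ i, ∑ j, α i j * L.load i * L.alloc i j k := by
  refine (hα.sum_usage_nonneg k).lt_of_ne' fun h₀ => h.ne' ?_
  rw [resCapacity, slack, h₀, div_zero, mul_zero, zero_mul, zero_mul]

lemma sum_resCapacity_eq (hα : L.IsFeasible ε α) (hε : 0 < ε) {i : Fin m} {k : Fin s}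
    (h : 0 < L.resCapacity ε α i k) : ∑ i, L.resCapacity ε α i k = L.capacity k := by
  have hq : 1 + 4 * ε ≠ 0 := by positivity
  rw [sum_resCapacity, slack, div_mul_cancel₀ _ (hα.sum_usage_pos_of_resCapacity_pos h).ne',
    ← mul_assoc, mul_one_div_cancel hq, one_mul]

lemma sum_resCapacity_le (hα : L.IsFeasible ε α) (hε : 0 < ε) (k : Fin s) :
    ∑ i, L.resCapacity ε α i k ≤ L.capacity k := by
  by_cases h : ∃ i, 0 < L.resCapacity ε α i k
  · exact (hα.sum_resCapacity_eq hε h.choose_spec).le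
  · exact (Finset.sum_nonpos fun i _ => not_lt.1 fun hi => h ⟨i, hi⟩).trans (L.capacity_nonneg k)

lemma resCapacity_eq_zero (hα : L.IsFeasible ε α) {i : Fin m} (hi : accFrac α i = 0) (k : Fin s) :
    L.resCapacity ε α i k = 0 := by
  have hzero := (Finset.sum_eq_zero_iff_of_nonneg fun j _ => hα.nonneg i j).1 hi
  rw [resCapacity, Finset.sum_eq_zero fun j hj => by rw [hzero j hj, zero_mul], mul_zero, zero_mul]

lemma load_mul_usage_div_le (hα : L.IsFeasible ε α) (hε : 0 < ε) (i : Fin m) (k : Fin s) :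
    L.load i * ((∑ j, α i j * L.alloc i j k) / L.resCapacity ε α i k) ≤ 1 / (1 + 4 * ε) := by
  rcases (hα.resCapacity_nonneg hε i k).eq_or_lt with hc | hc
  · rw [← hc, div_zero, mul_zero]
    positivity
  have hslack : 1 ≤ L.slack ε α k := by
    rw [slack, one_le_div (hα.sum_usage_pos_of_resCapacity_pos hc)]
    exact hα.sum_usage_le k
  have husage : 0 ≤ L.load i * ∑ j, α i j * L.alloc i j k :=
    mul_nonneg (load_pos i).le (hα.usage_nonneg i k)
  rw [← mul_div_assoc, div_le_iff₀ hc]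
  calc L.load i * ∑ j, α i j * L.alloc i j k
      ≤ L.slack ε α k * (L.load i * ∑ j, α i j * L.alloc i j k) :=
        le_mul_of_one_le_left husage hslack
    _ = 1 / (1 + 4 * ε) * L.resCapacity ε α i k := by
        rw [resCapacity]
        field_simp

lemma resWeight_nonneg (hα : L.IsFeasible ε α) (hε : 0 < ε) (hβ : 0 < β) (i : Fin m)
    (j : Fin (L.numAlloc i)) (k : Fin s) : 0 ≤ L.resWeight ε α β i j k :=
  mul_nonneg hβ.le (div_nonneg (L.alloc_nonneg i j k) (hα.resCapacity_nonneg hε i k))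

lemma sum_frac_mul_resWeight_le (hα : L.IsFeasible ε α) (hε : 0 < ε) (hβ : 0 < β) (i : Fin m)
    (k : Fin s) : ∑ j, α i j * L.resWeight ε α β i j k ≤ L.loadWeight ε β i := by
  have hsum : ∑ j, α i j * L.resWeight ε α β i j k =
      β * ((∑ j, α i j * L.alloc i j k) / L.resCapacity ε α i k) := by
    rw [Finset.sum_div, Finset.mul_sum]
    exact Finset.sum_congr rfl fun j _ => by rw [resWeight]; ring
  rw [hsum, loadWeight, div_eq_mul_one_div β, ← div_div]
  refine mul_le_mul_of_nonneg_left ?_ hβ.le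
  rw [le_div_iff₀ (load_pos i), mul_comm]
  exact hα.load_mul_usage_div_le hε i k

lemma fictCapacity_nonneg (hα : L.IsFeasible ε α) (hε : 0 < ε) (i : Fin m) :
    0 ≤ L.fictCapacity ε α i :=
  mul_nonneg (mul_nonneg (by positivity) (sub_nonneg.2 (hα.sum_le_one i))) (load_pos i).le

lemma fictWeight_nonneg (hα : L.IsFeasible ε α) (hε : 0 < ε) (hβ : 0 < β) (i : Fin m) :
    0 ≤ L.fictWeight ε α β i :=
  div_nonneg hβ.le (hα.fictCapacity_nonneg hε i)

end IsFeasible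

namespace IsAdmissible

lemma resCapacity_pos (hadm : L.IsAdmissible ε α β) (hα : L.IsFeasible ε α) (hε : 0 < ε)
    (hβ : 0 < β) {i : Fin m} {j : Fin (L.numAlloc i)} {k : Fin s} (h : 0 < L.alloc i j k) :
    0 < L.resCapacity ε α i k := by
  refine (hα.resCapacity_nonneg hε i k).lt_of_ne' fun hc => hβ.not_ge ?_
  simpa only [hc, zero_div, mul_zero] using hadm.le_res i j k h

lemma mul_alloc_le (hadm : L.IsAdmissible ε α β) (hα : L.IsFeasible ε α) (hε : 0 < ε) (i : Fin m)
    (j : Fin (L.numAlloc i)) (k : Fin s) : β * L.alloc i j k ≤ ε * L.resCapacity ε α i k := by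
  rcases (L.alloc_nonneg i j k).eq_or_lt with h | h
  · rw [← h, mul_zero]
    exact mul_nonneg hε.le (hα.resCapacity_nonneg hε i k)
  · have hle := hadm.le_res i j k h
    rwa [← mul_div_assoc, le_div_iff₀ h] at hle

lemma resWeight_le (hadm : L.IsAdmissible ε α β) (hα : L.IsFeasible ε α) (hε : 0 < ε) (i : Fin m)
    (j : Fin (L.numAlloc i)) (k : Fin s) : L.resWeight ε α β i j k ≤ ε := by
  rw [resWeight, ← mul_div_assoc]
  exact div_le_of_le_mul₀ (hα.resCapacity_nonneg hε i k) hε.le (hadm.mul_alloc_le hα hε i j k)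

lemma fictWeight_le (hadm : L.IsAdmissible ε α β) (hα : L.IsFeasible ε α) (hε : 0 < ε)
    (i : Fin m) : L.fictWeight ε α β i ≤ ε := by
  rw [fictWeight]
  rcases (hα.fictCapacity_nonneg hε i).eq_or_lt with h | h
  · rw [← h, div_zero]
    exact hε.le
  · rw [div_le_iff₀ h]
    refine hadm.le_fict i ((hα.sum_le_one i).lt_of_ne fun h₁ => h.ne' ?_)
    rw [fictCapacity_eq_zero_iff hε, accFrac, h₁, sub_self]

end IsAdmissible

variable (L) in
/-- The standing assumptions on the parameters of the penalty policy. -/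
structure IsTarget (ε : ℝ) (α : L.Fractions) (β : ℝ) : Prop where
  feasible : L.IsFeasible ε α
  admissible : L.IsAdmissible ε α β
  eps_pos : 0 < ε
  eps_lt : ε < 1 / 4
  beta_pos : 0 < β

variable (L) in
/-- The sum of the class `i` penalties over all resources and one further resource, which is never
used. -/
def penaltySum (ε : ℝ) (α : L.Fractions) (β : ℝ) (i : Fin m) (st : L.State) : ℝ :=
  1 + ∑ k, Real.exp (L.resExponent ε α β i k (st.1 i))

variable (L) in
/-- The marginal penalty `resMarginal` of allocation `j`, written out. -/
def marginal (ε : ℝ) (α : L.Fractions) (β : ℝ) (i : Fin m) (st : L.State)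
    (j : Fin (L.numAlloc i)) : ℝ :=
  ∑ k, L.resWeight ε α β i j k * Real.exp (L.resExponent ε α β i k (st.1 i))

variable (L) in
/-- The geometric mean, with weights `α_i` and `1 - α_i`, of the penalties of class `i` in the
network and in the fictitious system. It is a Lyapunov function: with these weights an arrival
changes it by the same bounded factor wherever the request is sent, as long as admitted requests
use an allocation of least marginal penalty. -/
def mixedPenalty (ε : ℝ) (α : L.Fractions) (β : ℝ) (i : Fin m) (st : L.State) : ℝ :=
  L.penaltySum ε α β i st ^ accFrac α i *
    Real.exp ((1 - accFrac α i) * L.fictWeight ε α β i * st.2 i)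

variable {i : Fin m} {st st' : L.State}

lemma resMarginal_eq_marginal (i : Fin m) (st : L.State) (j : Fin (L.numAlloc i)) :
    L.resMarginal ε α β i (fun a => (st.1 i a : ℝ)) j = L.marginal ε α β i st j := by
  refine Finset.sum_congr rfl fun k _ => ?_
  simp only [resPenalty_update]
  have hderiv := ((((hasDerivAt_id (st.1 i j : ℝ)).sub_const (st.1 i j : ℝ)).mul_const
    (L.resWeight ε α β i j k)).const_add (L.resExponent ε α β i k (st.1 i))).exp
  refine hderiv.deriv.trans ?_
  simp [mul_comm]

lemma isCheapest_iff {j : Fin (L.numAlloc i)} : L.IsCheapest ε α β st i j ↔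
    ∀ j', L.marginal ε α β i st j ≤ L.marginal ε α β i st j' := by
  simp only [IsCheapest, resMarginal_eq_marginal]

lemma condAccepted_iff : L.CondAccepted ε α β st i ↔
    ∃ j, L.fictCapacity ε α i = 0 ∨ L.marginal ε α β i st j ≤
      L.fictWeight ε α β i * Real.exp (L.fictWeight ε α β i * st.2 i) := by
  simp only [CondAccepted, fictMarginal, resMarginal_eq_marginal]
  refine exists_congr fun j => ?_
  by_cases h : L.fictCapacity ε α i = 0
  · simp [h]
  · rw [if_neg h, EReal.coe_le_coe_iff, deriv_fictPenalty]
    simp [h]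

lemma one_le_penaltySum (i : Fin m) (st : L.State) : 1 ≤ L.penaltySum ε α β i st :=
  le_add_of_nonneg_right (Finset.sum_nonneg fun _ _ => (Real.exp_pos _).le)

lemma penaltySum_pos (i : Fin m) (st : L.State) : 0 < L.penaltySum ε α β i st :=
  zero_lt_one.trans_le (one_le_penaltySum i st)

lemma exp_resExponent_le_penaltySum (i : Fin m) (k : Fin s) (st : L.State) :
    Real.exp (L.resExponent ε α β i k (st.1 i)) ≤ L.penaltySum ε α β i st :=
  (Finset.single_le_sum (f := fun k => Real.exp (L.resExponent ε α β i k (st.1 i)))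
    (fun _ _ => (Real.exp_pos _).le) (Finset.mem_univ k)).trans (le_add_of_nonneg_left zero_le_one)

lemma dependsOnClass_penaltySum (i : Fin m) : DependsOnClass i (L.penaltySum ε α β i) :=
  fun st st' h _ => by rw [penaltySum, penaltySum, h]

lemma mixedPenalty_pos (i : Fin m) (st : L.State) : 0 < L.mixedPenalty ε α β i st :=
  mul_pos (Real.rpow_pos_of_pos (penaltySum_pos i st) _) (Real.exp_pos _)

lemma dependsOnClass_mixedPenalty (i : Fin m) : DependsOnClass i (L.mixedPenalty ε α β i) :=
  fun st st' h h' => by rw [mixedPenalty, mixedPenalty, dependsOnClass_penaltySum i h h', h']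

lemma log_mixedPenalty (i : Fin m) (st : L.State) : Real.log (L.mixedPenalty ε α β i st) =
    accFrac α i * Real.log (L.penaltySum ε α β i st) +
      (1 - accFrac α i) * L.fictWeight ε α β i * st.2 i := by
  have hsum := penaltySum_pos (ε := ε) (α := α) (β := β) i st
  rw [mixedPenalty, Real.log_mul (Real.rpow_pos_of_pos hsum _).ne' (Real.exp_pos _).ne',
    Real.log_rpow hsum, Real.log_exp]

lemma exp_resExponent_update (i : Fin m) (k : Fin s) (x : Fin (L.numAlloc i) → ℕ)
    (j : Fin (L.numAlloc i)) (n : ℕ) :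
    Real.exp (L.resExponent ε α β i k (Function.update x j n)) =
      Real.exp (L.resExponent ε α β i k x) *
        Real.exp (((n : ℝ) - x j) * L.resWeight ε α β i j k) := by
  simp only [resExponent, Function.apply_update (fun _ => Nat.cast (R := ℝ)), sum_update_mul,
    Real.exp_add]

/-- Each penalty `P_k` satisfies `P_k log P_k ≥ P_k log A + P_k - A`, and `log P_k` is linear in the
numbers of requests. -/
lemma le_sum_mul_marginal (i : Fin m) (st : L.State) {A : ℝ} (hA : 0 < A) :
    L.penaltySum ε α β i st * Real.log A + L.penaltySum ε α β i st - (s + 1) * A ≤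
      ∑ j, (st.1 i j : ℝ) * L.marginal ε α β i st j := by
  have hsum : ∑ j, (st.1 i j : ℝ) * L.marginal ε α β i st j =
      ∑ k, Real.exp (L.resExponent ε α β i k (st.1 i)) * L.resExponent ε α β i k (st.1 i) := by
    simp only [marginal, resExponent, Finset.mul_sum]
    rw [Finset.sum_comm]
    exact Finset.sum_congr rfl fun k _ => Finset.sum_congr rfl fun j _ => by ring
  have htangent := Finset.sum_le_sum fun k (_ : k ∈ Finset.univ) =>
    mul_log_add_sub_le_mul_log (Real.exp_pos (L.resExponent ε α β i k (st.1 i))) hA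
  simp only [Real.log_exp, Finset.sum_sub_distrib, Finset.sum_add_distrib, ← Finset.sum_mul,
    Finset.sum_const, Finset.card_univ, Fintype.card_fin, nsmul_eq_mul] at htangent
  have hlog := Real.log_le_sub_one_of_pos hA
  rw [hsum, penaltySum]
  linarith

namespace IsTarget

lemma resWeight_nonneg (T : L.IsTarget ε α β) (i : Fin m) (j : Fin (L.numAlloc i))
    (k : Fin s) : 0 ≤ L.resWeight ε α β i j k :=
  T.feasible.resWeight_nonneg T.eps_pos T.beta_pos i j k

lemma resWeight_le (T : L.IsTarget ε α β) (i : Fin m) (j : Fin (L.numAlloc i))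
    (k : Fin s) : L.resWeight ε α β i j k ≤ ε :=
  T.admissible.resWeight_le T.feasible T.eps_pos i j k

lemma loadWeight_pos (T : L.IsTarget ε α β) (i : Fin m) : 0 < L.loadWeight ε β i :=
  LossNetwork.loadWeight_pos T.eps_pos T.beta_pos i

lemma accFrac_nonneg (T : L.IsTarget ε α β) (i : Fin m) : 0 ≤ accFrac α i :=
  T.feasible.accFrac_nonneg i

lemma accFrac_le_one (T : L.IsTarget ε α β) (i : Fin m) : accFrac α i ≤ 1 :=
  T.feasible.accFrac_le_one i

lemma fictWeight_nonneg (T : L.IsTarget ε α β) (i : Fin m) : 0 ≤ L.fictWeight ε α β i :=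
  T.feasible.fictWeight_nonneg T.eps_pos T.beta_pos i

lemma fictWeight_le (T : L.IsTarget ε α β) (i : Fin m) : L.fictWeight ε α β i ≤ ε :=
  T.admissible.fictWeight_le T.feasible T.eps_pos i

lemma one_sub_mul_fictWeight_nonneg (T : L.IsTarget ε α β) (i : Fin m) :
    0 ≤ (1 - accFrac α i) * L.fictWeight ε α β i :=
  mul_nonneg (sub_nonneg.2 (T.accFrac_le_one i)) (T.fictWeight_nonneg i)

lemma one_sub_mul_fictWeight_le_eps (T : L.IsTarget ε α β) (i : Fin m) :
    (1 - accFrac α i) * L.fictWeight ε α β i ≤ ε :=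
  (mul_le_of_le_one_left (T.fictWeight_nonneg i) (sub_le_self 1 (T.accFrac_nonneg i))).trans
    (T.fictWeight_le i)

lemma one_sub_mul_fictWeight_le (T : L.IsTarget ε α β) (i : Fin m) :
    (1 - accFrac α i) * L.fictWeight ε α β i ≤ L.loadWeight ε β i :=
  LossNetwork.one_sub_mul_fictWeight_le T.eps_pos T.beta_pos i

lemma marginal_nonneg (T : L.IsTarget ε α β) (i : Fin m) (st : L.State)
    (j : Fin (L.numAlloc i)) : 0 ≤ L.marginal ε α β i st j :=
  Finset.sum_nonneg fun k _ => mul_nonneg (T.resWeight_nonneg i j k) (Real.exp_pos _).le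

lemma marginal_le (T : L.IsTarget ε α β) (i : Fin m) (st : L.State)
    (j : Fin (L.numAlloc i)) : L.marginal ε α β i st j ≤ ε * L.penaltySum ε α β i st := by
  rw [penaltySum, mul_add, Finset.mul_sum, mul_one]
  exact (Finset.sum_le_sum fun k _ => mul_le_mul_of_nonneg_right (T.resWeight_le i j k)
    (Real.exp_pos _).le).trans (le_add_of_nonneg_left T.eps_pos.le)

lemma penaltySum_addReq_le (T : L.IsTarget ε α β) (i : Fin m) (st : L.State)
    (j : Fin (L.numAlloc i)) : L.penaltySum ε α β i (st.addReq i j) ≤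
      L.penaltySum ε α β i st + (1 + ε) * L.marginal ε α β i st j := by
  rw [penaltySum, penaltySum, marginal, Finset.mul_sum, add_assoc, ← Finset.sum_add_distrib]
  refine add_le_add_right (Finset.sum_le_sum fun k _ => ?_) 1
  rw [State.addReq_fst_self, exp_resExponent_update, Nat.cast_succ, add_sub_cancel_left, one_mul]
  have hexp := mul_le_mul_of_nonneg_left (exp_sub_one_le_mul (T.resWeight_nonneg i j k)
    (T.resWeight_le i j k) (T.eps_lt.le.trans (by norm_num)))
    (Real.exp_pos (L.resExponent ε α β i k (st.1 i))).le
  linarith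

lemma penaltySum_removeReq_le (T : L.IsTarget ε α β) {i : Fin m} {st : L.State}
    {j : Fin (L.numAlloc i)} (hj : 0 < st.1 i j) : L.penaltySum ε α β i (st.removeReq i j) ≤
      L.penaltySum ε α β i st - (1 - ε / 2) * L.marginal ε α β i st j := by
  rw [penaltySum, penaltySum, marginal, Finset.mul_sum, add_sub_assoc, ← Finset.sum_sub_distrib]
  refine add_le_add_right (Finset.sum_le_sum fun k _ => ?_) 1
  rw [State.removeReq_fst_self, exp_resExponent_update, Nat.cast_pred hj, sub_sub_cancel_left,
    neg_one_mul]
  have hexp := mul_le_mul_of_nonneg_left (exp_neg_sub_one_le_mul (T.resWeight_nonneg i j k)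
    (T.resWeight_le i j k)) (Real.exp_pos (L.resExponent ε α β i k (st.1 i))).le
  linarith

lemma sum_frac_mul_marginal_le (T : L.IsTarget ε α β) (i : Fin m) (st : L.State) :
    ∑ j, α i j * L.marginal ε α β i st j ≤
      L.loadWeight ε β i * (L.penaltySum ε α β i st - 1) := by
  have hsum : ∑ j, α i j * L.marginal ε α β i st j = ∑ k,
      (∑ j, α i j * L.resWeight ε α β i j k) * Real.exp (L.resExponent ε α β i k (st.1 i)) := by
    simp only [marginal, Finset.mul_sum, Finset.sum_mul, ← mul_assoc]
    exact Finset.sum_comm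
  rw [hsum, penaltySum, add_sub_cancel_left, Finset.mul_sum]
  exact Finset.sum_le_sum fun k _ => mul_le_mul_of_nonneg_right
    (T.feasible.sum_frac_mul_resWeight_le T.eps_pos T.beta_pos i k) (Real.exp_pos _).le

lemma accFrac_mul_le (T : L.IsTarget ε α β) {M : ℝ} (hM : ∀ j, M ≤ L.marginal ε α β i st j) :
    accFrac α i * M ≤ L.loadWeight ε β i * (L.penaltySum ε α β i st - 1) := by
  refine le_trans ?_ (T.sum_frac_mul_marginal_le i st)
  rw [accFrac, Finset.sum_mul]
  exact Finset.sum_le_sum fun j _ => mul_le_mul_of_nonneg_left (hM j) (T.feasible.nonneg i j)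

lemma accFrac_mul_marginal_le (T : L.IsTarget ε α β) {j : Fin (L.numAlloc i)}
    (hj : L.IsCheapest ε α β st i j) :
    accFrac α i * L.marginal ε α β i st j ≤ L.loadWeight ε β i * L.penaltySum ε α β i st :=
  (T.accFrac_mul_le (isCheapest_iff.1 hj)).trans
    (mul_le_mul_of_nonneg_left (sub_le_self _ zero_le_one) (T.loadWeight_pos i).le)

lemma le_two_mul_mixedPenalty (T : L.IsTarget ε α β) (hi : 0 < accFrac α i) {M : ℝ} (hM : 0 ≤ M)
    (hsum : accFrac α i * M ≤ L.penaltySum ε α β i st)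
    (hfict : (1 - accFrac α i) * M ≤ Real.exp (L.fictWeight ε α β i * st.2 i)) :
    M ≤ 2 * L.mixedPenalty ε α β i st := by
  rw [mixedPenalty, mul_assoc (1 - accFrac α i), mul_comm (1 - accFrac α i), Real.exp_mul]
  exact le_two_mul_rpow_mul_rpow hi (T.accFrac_le_one i) hM (by rwa [mul_comm])
    (Real.exp_pos _).le (by rwa [mul_comm])

lemma marginal_le_of_condAccepted (T : L.IsTarget ε α β) (hi : 0 < accFrac α i)
    {j : Fin (L.numAlloc i)} (hc : L.CondAccepted ε α β st i) (hj : L.IsCheapest ε α β st i j) :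
    L.marginal ε α β i st j ≤ L.loadWeight ε β i * (2 * L.mixedPenalty ε α β i st) := by
  have hη := T.loadWeight_pos i
  rw [← div_le_iff₀' hη]
  refine T.le_two_mul_mixedPenalty hi (div_nonneg (T.marginal_nonneg i st j) hη.le) ?_ ?_
  · rw [← mul_div_assoc, div_le_iff₀' hη]
    exact T.accFrac_mul_marginal_le hj
  · rw [← mul_div_assoc, div_le_iff₀' hη]
    obtain ⟨j', hzero | hle⟩ := condAccepted_iff.1 hc
    · rw [(fictCapacity_eq_zero_iff T.eps_pos i).1 hzero, zero_mul]
      positivity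
    · calc (1 - accFrac α i) * L.marginal ε α β i st j
          ≤ (1 - accFrac α i) *
              (L.fictWeight ε α β i * Real.exp (L.fictWeight ε α β i * st.2 i)) :=
            mul_le_mul_of_nonneg_left ((isCheapest_iff.1 hj j').trans hle)
              (sub_nonneg.2 (T.accFrac_le_one i))
        _ ≤ L.loadWeight ε β i * Real.exp (L.fictWeight ε α β i * st.2 i) := by
            rw [← mul_assoc]
            exact mul_le_mul_of_nonneg_right (T.one_sub_mul_fictWeight_le i) (Real.exp_pos _).le

end IsTarget

lemma nonempty_of_accFrac_pos (hi : 0 < accFrac α i) : Nonempty (Fin (L.numAlloc i)) := by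
  by_contra h
  rw [not_nonempty_iff] at h
  exact hi.ne' (Finset.sum_of_isEmpty _)

lemma fictCapacity_ne_zero_of_not_condAccepted (hi : 0 < accFrac α i)
    (hc : ¬ L.CondAccepted ε α β st i) : L.fictCapacity ε α i ≠ 0 := fun h =>
  hc (condAccepted_iff.2 (nonempty_of_accFrac_pos hi |>.elim fun j => ⟨j, Or.inl h⟩))

namespace IsTarget

lemma ne_zero_of_not_condAccepted (T : L.IsTarget ε α β) (hi : 0 < accFrac α i)
    (hc : ¬ L.CondAccepted ε α β st i) : s ≠ 0 := by
  rintro rfl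
  obtain ⟨j⟩ := nonempty_of_accFrac_pos hi
  refine hc (condAccepted_iff.2 ⟨j, Or.inr ?_⟩)
  rw [marginal, Finset.sum_of_isEmpty]
  exact mul_nonneg (T.fictWeight_nonneg i) (Real.exp_pos _).le

lemma exp_fictWeight_mul_le_of_not_condAccepted (T : L.IsTarget ε α β) (hi : 0 < accFrac α i)
    (hc : ¬ L.CondAccepted ε α β st i) :
    Real.exp (L.fictWeight ε α β i * st.2 i) ≤ 2 * L.mixedPenalty ε α β i st := by
  set Y := Real.exp (L.fictWeight ε α β i * st.2 i)
  have hcap := fictCapacity_ne_zero_of_not_condAccepted hi hc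
  have hb : 0 < 1 - accFrac α i := (sub_nonneg.2 (T.accFrac_le_one i)).lt_of_ne'
    ((fictCapacity_eq_zero_iff T.eps_pos i).not.1 hcap)
  have hcheap : ∀ j, L.fictWeight ε α β i * Y ≤ L.marginal ε α β i st j := fun j =>
    le_of_not_ge fun h => hc (condAccepted_iff.2 ⟨j, Or.inr h⟩)
  have hsum : accFrac α i * (Y / (1 - accFrac α i)) ≤ L.penaltySum ε α β i st - 1 := by
    refine le_of_mul_le_mul_left ?_ (T.loadWeight_pos i)
    refine le_of_eq_of_le ?_ (T.accFrac_mul_le hcheap)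
    rw [← one_sub_mul_fictWeight T.eps_pos i hcap]
    field_simp
  refine le_trans ?_ (T.le_two_mul_mixedPenalty hi (M := Y / (1 - accFrac α i)) (by positivity)
    (hsum.trans (sub_le_self _ zero_le_one)) (mul_div_cancel₀ _ hb.ne').le)
  exact le_div_self (Real.exp_pos _).le hb (sub_le_self 1 hi.le)

end IsTarget

/-! ### Drift of the penalties -/

variable {d : L.Rule}

lemma penaltySum_addFict (i : Fin m) (st : L.State) :
    L.penaltySum ε α β i (st.addFict i) = L.penaltySum ε α β i st := rfl

lemma penaltySum_removeFict (i : Fin m) (st : L.State) :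
    L.penaltySum ε α β i (st.removeFict i) = L.penaltySum ε α β i st := rfl

lemma mixedPenalty_addFict (i : Fin m) (st : L.State) : L.mixedPenalty ε α β i (st.addFict i) =
    L.mixedPenalty ε α β i st * Real.exp ((1 - accFrac α i) * L.fictWeight ε α β i) := by
  rw [mixedPenalty, mixedPenalty, penaltySum_addFict, State.addFict_snd_self, Nat.cast_succ,
    mul_add_one, Real.exp_add, mul_assoc (_ ^ _)]

lemma mixedPenalty_removeFict (h : 0 < st.2 i) : L.mixedPenalty ε α β i (st.removeFict i) =
    L.mixedPenalty ε α β i st * Real.exp (-((1 - accFrac α i) * L.fictWeight ε α β i)) := by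
  rw [mixedPenalty, mixedPenalty, penaltySum_removeFict, State.removeFict_snd_self,
    Nat.cast_pred h, mul_sub_one, sub_eq_add_neg, Real.exp_add, mul_assoc (_ ^ _)]

namespace IsTarget

lemma mixedPenalty_le_mul_of_penaltySum_le (T : L.IsTarget ε α β) {p : ℝ} (hp : -1 ≤ p)
    (hfict : st'.2 i = st.2 i)
    (hsum : L.penaltySum ε α β i st' ≤ L.penaltySum ε α β i st * (1 + p)) :
    L.mixedPenalty ε α β i st' ≤ L.mixedPenalty ε α β i st * (1 + accFrac α i * p) := by
  rw [mixedPenalty, mixedPenalty, hfict, mul_right_comm (_ ^ _)]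
  exact mul_le_mul_of_nonneg_right (rpow_le_of_le_mul_one_add (penaltySum_pos i st').le
    (penaltySum_pos i st).le hsum hp (T.accFrac_nonneg i) (T.accFrac_le_one i)) (Real.exp_pos _).le

lemma mixedPenalty_addFict_le (T : L.IsTarget ε α β) (i : Fin m) (st : L.State) :
    L.mixedPenalty ε α β i (st.addFict i) ≤
      L.mixedPenalty ε α β i st * (1 + (1 + ε) * L.loadWeight ε β i) := by
  rw [mixedPenalty_addFict]
  refine mul_le_mul_of_nonneg_left ?_ (mixedPenalty_pos i st).le
  have hexp := exp_sub_one_le_mul (T.one_sub_mul_fictWeight_nonneg i)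
    (T.one_sub_mul_fictWeight_le_eps i) (T.eps_lt.le.trans (by norm_num))
  have hweight := mul_le_mul_of_nonneg_left (T.one_sub_mul_fictWeight_le i)
    (add_pos zero_lt_one T.eps_pos).le
  linarith

lemma mixedPenalty_addReq_le (T : L.IsTarget ε α β) {j : Fin (L.numAlloc i)}
    (hj : L.IsCheapest ε α β st i j) : L.mixedPenalty ε α β i (st.addReq i j) ≤
      L.mixedPenalty ε α β i st * (1 + (1 + ε) * L.loadWeight ε β i) := by
  have hε := T.eps_pos
  have hF := penaltySum_pos (ε := ε) (α := α) (β := β) i st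
  have hD := T.marginal_nonneg i st j
  have hratio : accFrac α i * (L.marginal ε α β i st j / L.penaltySum ε α β i st) ≤
      L.loadWeight ε β i := by
    rw [← mul_div_assoc, div_le_iff₀ hF]
    exact T.accFrac_mul_marginal_le hj
  have hp : 0 ≤ (1 + ε) * (L.marginal ε α β i st j / L.penaltySum ε α β i st) := by positivity
  have hmixed := T.mixedPenalty_le_mul_of_penaltySum_le (st := st) (st' := st.addReq i j)
    (p := (1 + ε) * (L.marginal ε α β i st j / L.penaltySum ε α β i st)) (by linarith) rfl
    ((T.penaltySum_addReq_le i st j).trans_eq (by field_simp))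
  refine hmixed.trans (mul_le_mul_of_nonneg_left ?_ (mixedPenalty_pos i st).le)
  rw [mul_left_comm]
  gcongr

lemma mixedPenalty_afterArrival_le (T : L.IsTarget ε α β) (hd : L.IsPenaltyRule ε α β d)
    (i : Fin m) (st : L.State) : L.mixedPenalty ε α β i (L.afterArrival d i st) ≤
      L.mixedPenalty ε α β i st * (1 + (1 + ε) * L.loadWeight ε β i) := by
  rcases hdec : d i st with _ | j
  · rw [afterArrival_of_eq_none hdec]
    exact T.mixedPenalty_addFict_le i st
  · rw [afterArrival_of_eq_some hdec]
    exact T.mixedPenalty_addReq_le (hd.accept i st j hdec).2.1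

lemma mul_mixedPenalty_removeReq_sub_le (T : L.IsTarget ε α β) (i : Fin m) (st : L.State)
    (j : Fin (L.numAlloc i)) :
    (st.1 i j : ℝ) * (L.mixedPenalty ε α β i (st.removeReq i j) - L.mixedPenalty ε α β i st) ≤
      -((1 - ε / 2) * (accFrac α i * L.mixedPenalty ε α β i st / L.penaltySum ε α β i st) *
        (st.1 i j * L.marginal ε α β i st j)) := by
  rcases Nat.eq_zero_or_pos (st.1 i j) with hj | hj
  · simp [hj]
  have hF := penaltySum_pos (ε := ε) (α := α) (β := β) i st
  set p := L.marginal ε α β i st j / L.penaltySum ε α β i st with hp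
  have hp₀ : 0 ≤ p := div_nonneg (T.marginal_nonneg i st j) hF.le
  have hp₁ : p ≤ ε := (div_le_iff₀ hF).2 (T.marginal_le i st j)
  have hmixed := T.mixedPenalty_le_mul_of_penaltySum_le (st := st) (st' := st.removeReq i j)
    (p := -((1 - ε / 2) * p)) (by nlinarith [T.eps_pos, T.eps_lt]) rfl
    ((T.penaltySum_removeReq_le hj).trans_eq (by rw [hp]; field_simp; ring))
  calc (st.1 i j : ℝ) * (L.mixedPenalty ε α β i (st.removeReq i j) - L.mixedPenalty ε α β i st)
      ≤ st.1 i j * (L.mixedPenalty ε α β i st * (accFrac α i * -((1 - ε / 2) * p))) :=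
        mul_le_mul_of_nonneg_left (by linarith) (Nat.cast_nonneg _)
    _ = _ := by
        rw [hp]
        ring

lemma sum_mul_mixedPenalty_removeReq_sub_le (T : L.IsTarget ε α β) (i : Fin m) (st : L.State) :
    ∑ j, (st.1 i j : ℝ) *
        (L.mixedPenalty ε α β i (st.removeReq i j) - L.mixedPenalty ε α β i st) ≤
      -((1 - ε / 2) * L.mixedPenalty ε α β i st *
        (accFrac α i * (Real.log (L.penaltySum ε α β i st) - Real.log (s + 1)))) := by
  have hs : (0 : ℝ) < s + 1 := by positivity
  have hF := penaltySum_pos (ε := ε) (α := α) (β := β) i st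
  have hG := mixedPenalty_pos (ε := ε) (α := α) (β := β) i st
  have ha := T.accFrac_nonneg i
  have hκ : 0 ≤ 1 - ε / 2 := by linarith [T.eps_lt]
  have hmarginal := le_sum_mul_marginal (ε := ε) (α := α) (β := β) i st (div_pos hF hs)
  rw [mul_div_cancel₀ _ hs.ne', add_sub_cancel_right, Real.log_div hF.ne' hs.ne'] at hmarginal
  refine (Finset.sum_le_sum fun j _ => T.mul_mixedPenalty_removeReq_sub_le i st j).trans ?_
  rw [Finset.sum_neg_distrib, ← Finset.mul_sum]
  refine neg_le_neg ((mul_le_mul_of_nonneg_left hmarginal (by positivity)).trans_eq' ?_)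
  field_simp

lemma mul_mixedPenalty_removeFict_sub_le (T : L.IsTarget ε α β) (i : Fin m) (st : L.State) :
    (st.2 i : ℝ) * (L.mixedPenalty ε α β i (st.removeFict i) - L.mixedPenalty ε α β i st) ≤
      -((1 - ε / 2) * L.mixedPenalty ε α β i st *
        ((1 - accFrac α i) * L.fictWeight ε α β i * st.2 i)) := by
  rcases Nat.eq_zero_or_pos (st.2 i) with h | h
  · simp [h]
  rw [mixedPenalty_removeFict h]
  have hexp := mul_le_mul_of_nonneg_left (exp_neg_sub_one_le_mul
    (T.one_sub_mul_fictWeight_nonneg i) (T.one_sub_mul_fictWeight_le_eps i))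
    (mul_nonneg (Nat.cast_nonneg (st.2 i)) (mixedPenalty_pos (ε := ε) (α := α) (β := β) i st).le)
  linarith

/-- This is where the factor `1 + 4 ε` outweighs the second-order terms of all increments. -/
lemma arrivalRate_mul_loadWeight_le (T : L.IsTarget ε α β) (i : Fin m) :
    L.arrivalRate i * ((1 + ε) * L.loadWeight ε β i) ≤
      L.serviceRate i * ((1 - ε / 2) * (β * (1 - ε))) := by
  have hε := T.eps_pos
  have hμ := L.serviceRate_pos i
  have hl := L.arrivalRate_pos i
  have heps : (1 + ε) / (1 + 4 * ε) ≤ (1 - ε / 2) * (1 - ε) := by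
    rw [div_le_iff₀ (by positivity)]
    nlinarith [mul_pos hε (sub_pos.2 T.eps_lt), pow_pos hε 3]
  calc L.arrivalRate i * ((1 + ε) * L.loadWeight ε β i)
      = L.serviceRate i * β * ((1 + ε) / (1 + 4 * ε)) := by
        rw [loadWeight, load]
        field_simp
    _ ≤ L.serviceRate i * β * ((1 - ε / 2) * (1 - ε)) :=
        mul_le_mul_of_nonneg_left heps (mul_pos hμ T.beta_pos).le
    _ = L.serviceRate i * ((1 - ε / 2) * (β * (1 - ε))) := by ring

end IsTarget

/-- The level above which the drift of `mixedPenalty` is negative, for a class whose admitted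
fraction is `a`. -/
def mixedBound (s : ℕ) (ε β a : ℝ) : ℝ := (s + 1 : ℝ) ^ a * Real.exp (β * (1 - ε))

lemma mixedBound_pos (s : ℕ) (ε β a : ℝ) : 0 < mixedBound s ε β a :=
  mul_pos (Real.rpow_pos_of_pos (by positivity) a) (Real.exp_pos _)

lemma log_mixedBound (s : ℕ) (ε β a : ℝ) :
    Real.log (mixedBound s ε β a) = a * Real.log (s + 1) + β * (1 - ε) := by
  have hs : (0 : ℝ) < s + 1 := by positivity
  rw [mixedBound, Real.log_mul (Real.rpow_pos_of_pos hs a).ne' (Real.exp_pos _).ne',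
    Real.log_rpow hs, Real.log_exp]

lemma mixedBound_le (s : ℕ) (ε β : ℝ) {a : ℝ} (ha : a ≤ 1) :
    mixedBound s ε β a ≤ (s + 1) * Real.exp (β * (1 - ε)) :=
  mul_le_mul_of_nonneg_right
    ((Real.rpow_le_rpow_of_exponent_le (le_add_of_nonneg_left s.cast_nonneg) ha).trans_eq
      (Real.rpow_one _)) (Real.exp_pos _).le

namespace IsTarget

lemma generator_mixedPenalty_le (T : L.IsTarget ε α β) (hd : L.IsPenaltyRule ε α β d) (i : Fin m)
    (st : L.State) : L.generator d (L.mixedPenalty ε α β i) st ≤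
      L.serviceRate i * (1 - ε / 2) * mixedBound s ε β (accFrac α i) -
        L.serviceRate i * (1 - ε / 2) * L.mixedPenalty ε α β i st := by
  have hμ := L.serviceRate_pos i
  have hκ : 0 ≤ 1 - ε / 2 := by linarith [T.eps_lt]
  have hG := mixedPenalty_pos (ε := ε) (α := α) (β := β) i st
  have harrival : L.arrivalRate i *
      (L.mixedPenalty ε α β i (L.afterArrival d i st) - L.mixedPenalty ε α β i st) ≤
      L.serviceRate i * ((1 - ε / 2) * (β * (1 - ε))) * L.mixedPenalty ε α β i st :=
    calc L.arrivalRate i *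
        (L.mixedPenalty ε α β i (L.afterArrival d i st) - L.mixedPenalty ε α β i st)
      ≤ L.arrivalRate i * (L.mixedPenalty ε α β i st * ((1 + ε) * L.loadWeight ε β i)) :=
        mul_le_mul_of_nonneg_left (by linarith [T.mixedPenalty_afterArrival_le hd i st])
          (L.arrivalRate_pos i).le
    _ = L.arrivalRate i * ((1 + ε) * L.loadWeight ε β i) * L.mixedPenalty ε α β i st := by ring
    _ ≤ _ := mul_le_mul_of_nonneg_right (T.arrivalRate_mul_loadWeight_le i) hG.le
  have hreq := mul_le_mul_of_nonneg_left (T.sum_mul_mixedPenalty_removeReq_sub_le i st) hμ.le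
  have hfict := mul_le_mul_of_nonneg_left (T.mul_mixedPenalty_removeFict_sub_le i st) hμ.le
  have htangent := mul_le_mul_of_nonneg_left
    (mul_log_add_sub_le_mul_log hG (mixedBound_pos s ε β (accFrac α i))) (mul_nonneg hμ.le hκ)
  rw [log_mixedBound, log_mixedPenalty] at htangent
  rw [(dependsOnClass_mixedPenalty i).generator_eq]
  simp only [mul_assoc (L.serviceRate i), ← Finset.mul_sum]
  linarith

lemma penaltySum_afterArrival_le (T : L.IsTarget ε α β) (hd : L.IsPenaltyRule ε α β d)
    (hi : 0 < accFrac α i) (st : L.State) : L.penaltySum ε α β i (L.afterArrival d i st) ≤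
      L.penaltySum ε α β i st +
        (1 + ε) * (L.loadWeight ε β i * (2 * L.mixedPenalty ε α β i st)) := by
  have hε := T.eps_pos
  rcases hdec : d i st with _ | j
  · rw [afterArrival_of_eq_none hdec, penaltySum_addFict]
    have hη := T.loadWeight_pos i
    have hG := mixedPenalty_pos (ε := ε) (α := α) (β := β) i st
    exact le_add_of_nonneg_right (by positivity)
  · rw [afterArrival_of_eq_some hdec]
    obtain ⟨hc, hj, -⟩ := hd.accept i st j hdec
    refine (T.penaltySum_addReq_le i st j).trans ?_
    gcongr
    exact T.marginal_le_of_condAccepted hi hc hj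

lemma sum_mul_penaltySum_removeReq_sub_le (T : L.IsTarget ε α β) (i : Fin m) (st : L.State) :
    ∑ j, (st.1 i j : ℝ) * (L.penaltySum ε α β i (st.removeReq i j) - L.penaltySum ε α β i st) ≤
      -((1 - ε / 2) * ((β * (1 - ε) + 1) * L.penaltySum ε α β i st -
        (s + 1) * Real.exp (β * (1 - ε)))) := by
  have hκ : 0 ≤ 1 - ε / 2 := by linarith [T.eps_lt]
  have hmarginal := le_sum_mul_marginal (ε := ε) (α := α) (β := β) i st
    (Real.exp_pos (β * (1 - ε)))
  rw [Real.log_exp] at hmarginal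
  have hterm (j : Fin (L.numAlloc i)) : (st.1 i j : ℝ) *
      (L.penaltySum ε α β i (st.removeReq i j) - L.penaltySum ε α β i st) ≤
      -((1 - ε / 2) * (st.1 i j * L.marginal ε α β i st j)) := by
    rcases Nat.eq_zero_or_pos (st.1 i j) with hj | hj
    · simp [hj]
    · have hle := mul_le_mul_of_nonneg_left (T.penaltySum_removeReq_le hj)
        (Nat.cast_nonneg (α := ℝ) (st.1 i j))
      linarith
  refine (Finset.sum_le_sum fun j _ => hterm j).trans ?_
  rw [Finset.sum_neg_distrib, ← Finset.mul_sum]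
  exact neg_le_neg (mul_le_mul_of_nonneg_left (by linarith) hκ)

lemma generator_penaltySum_le (T : L.IsTarget ε α β) (hd : L.IsPenaltyRule ε α β d)
    (hi : 0 < accFrac α i) (st : L.State) : L.generator d (L.penaltySum ε α β i) st ≤
      L.serviceRate i * (1 - ε / 2) * (2 * (β * (1 - ε)) * L.mixedPenalty ε α β i st +
        (s + 1) * Real.exp (β * (1 - ε))) -
      L.serviceRate i * (1 - ε / 2) * (β * (1 - ε) + 1) * L.penaltySum ε α β i st := by
  have hG := mixedPenalty_pos (ε := ε) (α := α) (β := β) i st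
  have harrival := mul_le_mul_of_nonneg_left
    (sub_le_iff_le_add'.2 (T.penaltySum_afterArrival_le hd hi st)) (L.arrivalRate_pos i).le
  have hrate := mul_le_mul_of_nonneg_right (T.arrivalRate_mul_loadWeight_le i)
    (mul_pos two_pos hG).le
  have hreq := mul_le_mul_of_nonneg_left (T.sum_mul_penaltySum_removeReq_sub_le i st)
    (L.serviceRate_pos i).le
  rw [(dependsOnClass_penaltySum i).generator_eq, penaltySum_removeFict]
  simp only [mul_assoc (L.serviceRate i), ← Finset.mul_sum]
  linarith

end IsTarget

variable {y₀ : Fin m → ℕ} {Ω : Type*} [mΩ : MeasurableSpace Ω] {P : Measure Ω}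
  {ℱ : Filtration ℝ≥0 mΩ} {S : ℝ≥0 → Ω → L.State}

lemma hasExpGrowth_snd (i : Fin m) : (L.dynamics d).HasExpGrowth fun st => (st.2 i : ℝ) :=
  .natCast_of_le_size fun st => st.snd_le_total i

lemma hasExpGrowth_classTotal (i : Fin m) :
    (L.dynamics d).HasExpGrowth fun st => (st.classTotal i : ℝ) :=
  .natCast_of_le_size fun st => st.classTotal_le_total i

lemma hasExpGrowth_penaltySum (i : Fin m) :
    (L.dynamics d).HasExpGrowth (L.penaltySum ε α β i) := by
  refine .add (.const 1) (.sum _ fun k _ => ?_)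
  simp only [resExponent, Real.exp_sum, mul_comm _ (L.resWeight ε α β i _ k)]
  exact .prod _ fun j _ => .exp_natCast_of_le_size (fun st => st.fst_le_total i j) _

lemma penaltySum_initial (i : Fin m) (y₀ : Fin m → ℕ) :
    L.penaltySum ε α β i (fun _ _ => 0, y₀) = s + 1 := by
  simp [penaltySum, resExponent, add_comm]

namespace IsTarget

lemma hasExpGrowth_mixedPenalty (T : L.IsTarget ε α β) (i : Fin m) :
    (L.dynamics d).HasExpGrowth (L.mixedPenalty ε α β i) := by
  have hexp : (L.dynamics d).HasExpGrowth fun st =>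
      Real.exp ((1 - accFrac α i) * L.fictWeight ε α β i * st.2 i) :=
    .exp_natCast_of_le_size (fun st => st.snd_le_total i) _
  refine ((hasExpGrowth_penaltySum (ε := ε) (α := α) (β := β) i).mul hexp).mono fun st => ?_
  rw [abs_of_pos (mixedPenalty_pos i st),
    abs_of_pos (mul_pos (penaltySum_pos i st) (Real.exp_pos _))]
  refine mul_le_mul_of_nonneg_right ?_ (Real.exp_pos _).le
  exact (Real.rpow_le_rpow_of_exponent_le (one_le_penaltySum i st) (T.accFrac_le_one i)).trans_eq
    (Real.rpow_one _)

lemma mixedPenalty_initial_le (T : L.IsTarget ε α β)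
    (hy₀ : (y₀ i : ℝ) = (1 - accFrac α i) * L.load i) :
    L.mixedPenalty ε α β i (fun _ _ => 0, y₀) ≤ mixedBound s ε β (accFrac α i) := by
  have hε := T.eps_pos
  have hload := L.load_pos i
  have heps : 1 / (1 + 4 * ε) ≤ 1 - ε := by
    rw [div_le_iff₀ (by positivity)]
    nlinarith [mul_pos hε (sub_pos.2 T.eps_lt)]
  rw [mixedPenalty, mixedBound, penaltySum_initial]
  refine mul_le_mul_of_nonneg_left (Real.exp_le_exp.2 ?_) (by positivity)
  calc (1 - accFrac α i) * L.fictWeight ε α β i * y₀ i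
      ≤ L.loadWeight ε β i * y₀ i :=
        mul_le_mul_of_nonneg_right (T.one_sub_mul_fictWeight_le i) (Nat.cast_nonneg _)
    _ ≤ L.loadWeight ε β i * L.load i := by
        rw [hy₀]
        exact mul_le_mul_of_nonneg_left (mul_le_of_le_one_left hload.le
          (sub_le_self 1 (T.accFrac_nonneg i))) (T.loadWeight_pos i).le
    _ = β * (1 / (1 + 4 * ε)) := by
        rw [loadWeight]
        field_simp
    _ ≤ β * (1 - ε) := mul_le_mul_of_nonneg_left heps T.beta_pos.le

variable [IsProbabilityMeasure P]

lemma integral_mixedPenalty_le (T : L.IsTarget ε α β) (hd : L.IsPenaltyRule ε α β d)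
    (hS : L.IsStateChain d y₀ P ℱ S) (hy₀ : (y₀ i : ℝ) = (1 - accFrac α i) * L.load i) (t : ℝ≥0) :
    ∫ ω, L.mixedPenalty ε α β i (S t ω) ∂P ≤ (s + 1) * Real.exp (β * (1 - ε)) := by
  refine le_trans ?_ (mixedBound_le s ε β (T.accFrac_le_one i))
  refine hS.isChain.integral_le_of_drift_of_initial_le (T.hasExpGrowth_mixedPenalty i)
    (a := L.serviceRate i * (1 - ε / 2))
    (.const (L.serviceRate i * (1 - ε / 2) * mixedBound s ε β (accFrac α i)))
    (fun st => ?_) (fun _ => by simp) (T.mixedPenalty_initial_le hy₀) t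
  exact generator_dynamics d (L.mixedPenalty ε α β i) ▸ T.generator_mixedPenalty_le hd i st

lemma integral_penaltySum_le (T : L.IsTarget ε α β) (hd : L.IsPenaltyRule ε α β d)
    (hS : L.IsStateChain d y₀ P ℱ S) (hi : 0 < accFrac α i)
    (hy₀ : (y₀ i : ℝ) = (1 - accFrac α i) * L.load i) (t : ℝ≥0) :
    ∫ ω, L.penaltySum ε α β i (S t ω) ∂P ≤ 2 * ((s + 1) * Real.exp (β * (1 - ε))) := by
  have hμ := L.serviceRate_pos i
  have hκ : 0 < 1 - ε / 2 := by linarith [T.eps_lt]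
  have hv : 0 < β * (1 - ε) := mul_pos T.beta_pos (by linarith [T.eps_lt])
  have hG : (L.dynamics d).HasExpGrowth (L.mixedPenalty ε α β i) := T.hasExpGrowth_mixedPenalty i
  refine hS.isChain.integral_le_of_drift_of_initial_le (hasExpGrowth_penaltySum i)
    (((hG.const_mul (2 * (β * (1 - ε)))).add (.const ((s + 1) * Real.exp (β * (1 - ε))))).const_mul
      (L.serviceRate i * (1 - ε / 2)))
    (fun st => generator_dynamics d (L.penaltySum ε α β i) ▸ T.generator_penaltySum_le hd hi st)
    (fun t => ?_) ?_ t
  · have h_int := hS.isChain.integrable_comp hG t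
    have hmixed := mul_le_mul_of_nonneg_left (T.integral_mixedPenalty_le hd hS hy₀ t)
      (mul_pos two_pos hv).le
    rw [integral_const_mul, integral_add (h_int.const_mul _) (integrable_const _),
      integral_const_mul, mul_assoc (L.serviceRate i * (1 - ε / 2)), integral_const, probReal_univ,
      one_smul]
    have hpos : 0 < (s + 1) * Real.exp (β * (1 - ε)) := by positivity
    exact mul_le_mul_of_nonneg_left (by linarith) (by positivity)
  · rw [penaltySum_initial]
    nlinarith [Real.one_le_exp hv.le]

end IsTarget

variable (L) in
/-- The sum over the resources `k` of the averages of the `penaltySum`s of all classes with weights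
`c⁰_ik / b_k`. It is large when an allocation does not fit. -/
def usagePenalty (ε : ℝ) (α : L.Fractions) (β : ℝ) (st : L.State) : ℝ :=
  ∑ k, ∑ i, L.resCapacity ε α i k / L.capacity k * L.penaltySum ε α β i st

lemma hasExpGrowth_usagePenalty : (L.dynamics d).HasExpGrowth (L.usagePenalty ε α β) :=
  .sum _ fun _ _ => .sum _ fun i _ => (hasExpGrowth_penaltySum i).const_mul _

namespace IsTarget

lemma resCapacity_div_capacity_nonneg (T : L.IsTarget ε α β) (i : Fin m) (k : Fin s) :
    0 ≤ L.resCapacity ε α i k / L.capacity k :=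
  div_nonneg (T.feasible.resCapacity_nonneg T.eps_pos i k) (L.capacity_nonneg k)

lemma mul_sum_alloc_mul_eq (T : L.IsTarget ε α β) (i : Fin m) (k : Fin s)
    (x : Fin (L.numAlloc i) → ℕ) : β * ∑ j, L.alloc i j k * (x j : ℝ) =
      L.resCapacity ε α i k * L.resExponent ε α β i k x := by
  rw [resExponent, Finset.mul_sum, Finset.mul_sum]
  refine Finset.sum_congr rfl fun j _ => ?_
  rw [resWeight]
  rcases (L.alloc_nonneg i j k).eq_or_lt with h | h
  · simp [← h]
  · have hcap := (T.admissible.resCapacity_pos T.feasible T.eps_pos T.beta_pos h).ne'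
    field_simp

lemma exists_capacity_lt_of_not_fits (T : L.IsTarget ε α β) {j : Fin (L.numAlloc i)}
    (h : ¬ L.Fits st i j) : ∃ k, 0 < L.capacity k ∧ ∑ i', L.resCapacity ε α i' k = L.capacity k ∧
      (β - ε) * L.capacity k <
        ∑ i', L.resCapacity ε α i' k * L.resExponent ε α β i' k (st.1 i') := by
  have hnonneg := fun i k => T.feasible.resCapacity_nonneg T.eps_pos i k
  simp only [Fits, not_forall, not_le] at h
  obtain ⟨k, hk⟩ := h
  have hlt := mul_lt_mul_of_pos_left hk T.beta_pos
  rw [mul_add, Finset.mul_sum] at hlt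
  simp only [T.mul_sum_alloc_mul_eq _ k] at hlt
  have hle := T.admissible.mul_alloc_le T.feasible T.eps_pos i j k
  have hsingle : L.resCapacity ε α i k ≤ ∑ i', L.resCapacity ε α i' k :=
    Finset.single_le_sum (f := fun i => L.resCapacity ε α i k) (fun i _ => hnonneg i k)
      (Finset.mem_univ i)
  obtain ⟨i₀, hi₀⟩ : ∃ i₀, 0 < L.resCapacity ε α i₀ k := by
    by_contra! hno
    have hzero (i' : Fin m) : L.resCapacity ε α i' k = 0 := (hno i').antisymm (hnonneg i' k)
    simp only [hzero, zero_mul, Finset.sum_const_zero, mul_zero, zero_add] at hlt hle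
    exact (hlt.trans_le hle).not_ge (mul_nonneg T.beta_pos.le (L.capacity_nonneg k))
  have hsum := T.feasible.sum_resCapacity_eq T.eps_pos hi₀
  have hpos : 0 < L.capacity k := hsum ▸ Finset.sum_pos' (fun i _ => hnonneg i k)
    ⟨i₀, Finset.mem_univ i₀, hi₀⟩
  have hsmall := mul_le_mul_of_nonneg_left (hsingle.trans_eq hsum) T.eps_pos.le
  exact ⟨k, hpos, hsum, by linarith⟩

lemma usagePenalty_nonneg (T : L.IsTarget ε α β) (st : L.State) : 0 ≤ L.usagePenalty ε α β st :=
  Finset.sum_nonneg fun k _ => Finset.sum_nonneg fun i _ =>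
    mul_nonneg (T.resCapacity_div_capacity_nonneg i k) (penaltySum_pos i st).le

/-- By Jensen's inequality, since the weights `c⁰_ik / b_k` of an exceeded resource sum to one. -/
lemma exp_le_usagePenalty_of_not_fits (T : L.IsTarget ε α β) {j : Fin (L.numAlloc i)}
    (h : ¬ L.Fits st i j) : Real.exp (β - ε) ≤ L.usagePenalty ε α β st := by
  obtain ⟨k, hpos, hsum, hlt⟩ := T.exists_capacity_lt_of_not_fits h
  have hw (i : Fin m) := T.resCapacity_div_capacity_nonneg i k
  have hjensen := convexOn_exp.map_sum_le (t := Finset.univ)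
    (w := fun i => L.resCapacity ε α i k / L.capacity k)
    (p := fun i => L.resExponent ε α β i k (st.1 i)) (fun i _ => hw i)
    (by rw [← Finset.sum_div, hsum, div_self hpos.ne']) (fun _ _ => Set.mem_univ _)
  simp only [smul_eq_mul] at hjensen
  calc Real.exp (β - ε)
      ≤ Real.exp (∑ i, L.resCapacity ε α i k / L.capacity k *
          L.resExponent ε α β i k (st.1 i)) := by
        simp only [Real.exp_le_exp, div_mul_eq_mul_div, ← Finset.sum_div]
        exact (le_div_iff₀ hpos).2 hlt.le
    _ ≤ ∑ i, L.resCapacity ε α i k / L.capacity k *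
          Real.exp (L.resExponent ε α β i k (st.1 i)) := hjensen
    _ ≤ ∑ i, L.resCapacity ε α i k / L.capacity k * L.penaltySum ε α β i st :=
        Finset.sum_le_sum fun i _ =>
          mul_le_mul_of_nonneg_left (exp_resExponent_le_penaltySum i k st) (hw i)
    _ ≤ L.usagePenalty ε α β st :=
        Finset.single_le_sum (f := fun k => ∑ i, L.resCapacity ε α i k / L.capacity k *
          L.penaltySum ε α β i st) (fun k _ => Finset.sum_nonneg fun i _ =>
            mul_nonneg (T.resCapacity_div_capacity_nonneg i k) (penaltySum_pos i st).le)
          (Finset.mem_univ k)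

lemma integral_usagePenalty_le [IsProbabilityMeasure P] (T : L.IsTarget ε α β)
    (hd : L.IsPenaltyRule ε α β d) (hS : L.IsStateChain d y₀ P ℱ S)
    (hy₀ : ∀ i, (y₀ i : ℝ) = (1 - accFrac α i) * L.load i) (t : ℝ≥0) :
    ∫ ω, L.usagePenalty ε α β (S t ω) ∂P ≤ s * (2 * ((s + 1) * Real.exp (β * (1 - ε)))) := by
  set B : ℝ := 2 * ((s + 1) * Real.exp (β * (1 - ε)))
  have h_int (i : Fin m) (k : Fin s) :=
    (hS.isChain.integrable_comp (hasExpGrowth_penaltySum (ε := ε) (α := α) (β := β) i) t).const_mul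
      (L.resCapacity ε α i k / L.capacity k)
  have hterm (i : Fin m) (k : Fin s) : L.resCapacity ε α i k / L.capacity k *
      ∫ ω, L.penaltySum ε α β i (S t ω) ∂P ≤ L.resCapacity ε α i k / L.capacity k * B := by
    rcases (T.accFrac_nonneg i).eq_or_lt with hi | hi
    · simp only [T.feasible.resCapacity_eq_zero hi.symm, zero_div, zero_mul, le_refl]
    · exact mul_le_mul_of_nonneg_left (T.integral_penaltySum_le hd hS hi (hy₀ i) t)
        (T.resCapacity_div_capacity_nonneg i k)
  calc ∫ ω, L.usagePenalty ε α β (S t ω) ∂P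
      = ∑ k, ∑ i, L.resCapacity ε α i k / L.capacity k *
          ∫ ω, L.penaltySum ε α β i (S t ω) ∂P := by
        simp only [usagePenalty]
        rw [integral_finsetSum _ fun k _ => integrable_finsetSum _ fun i _ => h_int i k]
        simp only [integral_finsetSum _ fun i _ => h_int i _, integral_const_mul]
    _ ≤ ∑ k : Fin s, (∑ i, L.resCapacity ε α i k) / L.capacity k * B := by
        simp only [Finset.sum_div, Finset.sum_mul]
        exact Finset.sum_le_sum fun k _ => Finset.sum_le_sum fun i _ => hterm i k
    _ ≤ ∑ _k : Fin s, 1 * B := Finset.sum_le_sum fun k _ => mul_le_mul_of_nonneg_right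
        (div_le_one_of_le₀ (T.feasible.sum_resCapacity_le T.eps_pos k) (L.capacity_nonneg k))
        (by positivity)
    _ = s * B := by simp

end IsTarget

end LossNetwork

lemma two_mul_add_two_mul_sq_le (s : ℕ) {a b : ℝ} (ha : 1 ≤ a) (hb : 0 < b)
    (h : (s + 1 : ℝ) ^ 2 * (a ^ 2 * b) ≤ 1) :
    2 * s * (a * b) + 2 * s * (s + 1) * (a * b ^ 2) ≤ (s + 1 : ℝ) ^ 2 * (a ^ 2 * b) := by
  rcases Nat.eq_zero_or_pos s with rfl | hs
  · simp only [Nat.cast_zero, mul_zero, zero_mul, add_zero]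
    positivity
  have hs : (1 : ℝ) ≤ s := by exact_mod_cast hs
  have hab : a * b ≤ a ^ 2 * b :=
    mul_le_mul_of_nonneg_right (le_self_pow₀ ha two_ne_zero) hb.le
  have hb_le : b ≤ a ^ 2 * b := le_mul_of_one_le_left hb.le (one_le_pow₀ ha)
  have hsb : (s : ℝ) * (s + 1) * b ≤ 1 :=
    (mul_le_mul (by nlinarith) hb_le hb.le (by positivity)).trans h
  calc 2 * s * (a * b) + 2 * s * (s + 1) * (a * b ^ 2)
      = 2 * s * (a * b) + 2 * (s * (s + 1) * b) * (a * b) := by ring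
    _ ≤ 2 * s * (a * b) + 2 * 1 * (a * b) := by gcongr
    _ = 2 * (s + 1) * (a * b) := by ring
    _ ≤ (s + 1) * (s + 1) * (a ^ 2 * b) := by gcongr; linarith
    _ = (s + 1) ^ 2 * (a ^ 2 * b) := by ring

lemma two_mul_exp_add_two_mul_exp_le (s : ℕ) {ε β : ℝ} (hε : 0 ≤ ε)
    (h : (s + 1 : ℝ) ^ 2 * Real.exp (-(ε / 2) * (β - 4)) ≤ 1) :
    2 * s * Real.exp (ε - ε / 2 * β) + 2 * s * (s + 1) * Real.exp (ε - ε * β) ≤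
      (s + 1 : ℝ) ^ 2 * Real.exp (-(ε / 2) * (β - 4)) := by
  have ha₂b : Real.exp (-(ε / 2) * (β - 4)) = Real.exp ε ^ 2 * Real.exp (-(ε / 2 * β)) := by
    rw [← Real.exp_nat_mul, ← Real.exp_add]
    congr 1
    push_cast
    ring
  have hab : Real.exp (ε - ε / 2 * β) = Real.exp ε * Real.exp (-(ε / 2 * β)) := by
    rw [← Real.exp_add, sub_eq_add_neg]
  have hab₂ : Real.exp (ε - ε * β) = Real.exp ε * Real.exp (-(ε / 2 * β)) ^ 2 := by
    rw [← Real.exp_nat_mul, ← Real.exp_add]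
    congr 1
    push_cast
    ring
  rw [ha₂b] at h ⊢
  rw [hab, hab₂]
  exact two_mul_add_two_mul_sq_le s (Real.one_le_exp hε) (Real.exp_pos _) h

namespace LossNetwork

variable {m s : ℕ} {L : LossNetwork m s} {ε β : ℝ} {α : L.Fractions} {d : L.Rule} {i : Fin m}
  {st : L.State} {y₀ : Fin m → ℕ} {Ω : Type*} [mΩ : MeasurableSpace Ω] {P : Measure Ω}
  {ℱ : Filtration ℝ≥0 mΩ} {S : ℝ≥0 → Ω → L.State}

/-! ### Rejected requests -/

lemma natCast_mul_max_pred_sub_le {A : ℝ} (hA : 0 ≤ A) (n : ℕ) :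
    (n : ℝ) * (max ((n - 1 : ℕ) - A) 0 - max (n - A) 0) ≤ -max (n - A) 0 := by
  rcases Nat.eq_zero_or_pos n with rfl | hn
  · simp [hA]
  have hn' : (1 : ℝ) ≤ n := by exact_mod_cast hn
  rw [Nat.cast_pred hn]
  rcases le_total (n : ℝ) A with h | h
  · rw [max_eq_right (by linarith), max_eq_right (by linarith)]
    simp
  rw [max_eq_left (a := n - A) (by linarith)]
  rcases le_total ((n : ℝ) - 1 - A) 0 with h' | h'
  · rw [max_eq_right h']
    nlinarith
  · rw [max_eq_left h']
    linarith

lemma hasExpGrowth_excess {A : ℝ} (hA : 0 ≤ A) (i : Fin m) :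
    (L.dynamics d).HasExpGrowth fun st => max (st.2 i - A) 0 := by
  refine (hasExpGrowth_snd i).mono fun st => ?_
  have hy : (0 : ℝ) ≤ st.2 i := Nat.cast_nonneg _
  rw [abs_of_nonneg hy, abs_of_nonneg (le_max_right _ _)]
  exact max_le (sub_le_self _ hA) hy

lemma excess_afterArrival_sub_le {A b : ℝ} (hb : 0 ≤ b)
    (hreject : d i st = none → A < st.2 i + 1 → 1 ≤ b) :
    max ((L.afterArrival d i st).2 i - A) 0 - max (st.2 i - A) 0 ≤ b := by
  rcases hdec : d i st with _ | j
  · rw [afterArrival_of_eq_none hdec, State.addFict_snd_self]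
    push_cast
    rcases lt_or_ge A (st.2 i + 1) with h | h
    · have hone := hreject hdec h
      have hmax : max ((st.2 i : ℝ) + 1 - A) 0 ≤ max (st.2 i - A) 0 + 1 :=
        max_le (by linarith [le_max_left ((st.2 i : ℝ) - A) 0])
          (by linarith [le_max_right ((st.2 i : ℝ) - A) 0])
      linarith
    · rw [max_eq_right (by linarith)]
      linarith [le_max_right ((st.2 i : ℝ) - A) 0]
  · rwa [afterArrival_of_eq_some hdec, State.addReq_snd, sub_self]

lemma generator_excess_le {A : ℝ} (hA : 0 ≤ A) {B : L.State → ℝ} (hB : ∀ st, 0 ≤ B st)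
    (hreject : ∀ st, d i st = none → A < st.2 i + 1 → 1 ≤ B st) (st : L.State) :
    L.generator d (fun st => max (st.2 i - A) 0) st ≤
      L.arrivalRate i * B st - L.serviceRate i * max (st.2 i - A) 0 := by
  have hdep : DependsOnClass (L := L) i fun st => max (st.2 i - A) 0 :=
    fun _ _ _ h => by simp only [h]
  have harr := mul_le_mul_of_nonneg_left (excess_afterArrival_sub_le (hB st) (hreject st))
    (L.arrivalRate_pos i).le
  have hserv := mul_le_mul_of_nonneg_left (natCast_mul_max_pred_sub_le hA (st.2 i))
    (L.serviceRate_pos i).le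
  rw [hdep.generator_eq]
  simp only [State.removeReq_snd, State.removeFict_snd_self, sub_self, mul_zero,
    Finset.sum_const_zero, add_zero]
  linarith

lemma serviceRate_mul_load (i : Fin m) : L.serviceRate i * L.load i = L.arrivalRate i :=
  mul_div_cancel₀ _ (L.serviceRate_pos i).ne'

namespace IsStateChain

variable [IsProbabilityMeasure P]

lemma integral_snd_le (hS : L.IsStateChain d y₀ P ℱ S) {A δ : ℝ} (hy₀ : (y₀ i : ℝ) ≤ A)
    {B : L.State → ℝ} (hBg : (L.dynamics d).HasExpGrowth B) (hB : ∀ st, 0 ≤ B st)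
    (hreject : ∀ st, d i st = none → A < st.2 i + 1 → 1 ≤ B st)
    (hδ : ∀ t, ∫ ω, B (S t ω) ∂P ≤ δ) (t : ℝ≥0) :
    ∫ ω, ((S t ω).2 i : ℝ) ∂P ≤
      A + δ * (L.load i * (1 - Real.exp (-L.serviceRate i * t))) := by
  have hA : 0 ≤ A := (Nat.cast_nonneg _).trans hy₀
  have hexc : (L.dynamics d).HasExpGrowth fun st => max (st.2 i - A) 0 := hasExpGrowth_excess hA i
  have h_int := hS.isChain.integrable_comp hexc t
  have hdrift := hS.isChain.integral_le_of_drift hexc (hBg.const_mul (L.arrivalRate i))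
    (a := L.serviceRate i) (K := δ * L.load i)
    (fun st => (congrFun (generator_dynamics d _) st).trans_le
      (generator_excess_le hA hB hreject st))
    (fun t => by
      rw [integral_const_mul, mul_left_comm, serviceRate_mul_load, mul_comm δ]
      exact mul_le_mul_of_nonneg_left (hδ t) (L.arrivalRate_pos i).le) t
  calc ∫ ω, ((S t ω).2 i : ℝ) ∂P
      ≤ ∫ ω, (A + max ((S t ω).2 i - A) 0) ∂P :=
        integral_mono (hS.isChain.integrable_comp (hasExpGrowth_snd i) t)
          ((integrable_const A).add h_int) fun ω => sub_le_iff_le_add'.1 (le_max_left _ _)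
    _ = A + ∫ ω, max ((S t ω).2 i - A) 0 ∂P := by
        rw [integral_add (integrable_const A) h_int, integral_const, probReal_univ, one_smul]
    _ ≤ A + δ * (L.load i * (1 - Real.exp (-L.serviceRate i * t))) := by
        rw [max_eq_right (sub_nonpos.2 hy₀)] at hdrift
        linarith

/-- The total number of class `i` requests is an `M/M/∞` queue, whatever the rule is. -/
lemma integral_classTotal (hS : L.IsStateChain d y₀ P ℱ S) (i : Fin m) (t : ℝ≥0) :
    ∫ ω, ((S t ω).classTotal i : ℝ) ∂P =
      L.load i + (y₀ i - L.load i) * Real.exp (-L.serviceRate i * t) := by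
  rw [hS.isChain.integral_eq_of_drift (hasExpGrowth_classTotal i) (a := L.serviceRate i)
    (K := L.load i) (fun st => ?_) t]
  · simp [State.classTotal]
  · rw [generator_dynamics, generator_classTotal, serviceRate_mul_load]

end IsStateChain

lemma hasExpGrowth_rewardRate : (L.dynamics d).HasExpGrowth L.rewardRate :=
  .sum _ fun i _ => .const_mul (.sum _ fun j _ =>
    .natCast_of_le_size fun st => st.fst_le_total i j) _

lemma IsStateChain.integral_rewardRate [IsProbabilityMeasure P]
    (hS : L.IsStateChain d y₀ P ℱ S) (t : ℝ≥0) :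
    ∫ ω, L.rewardRate (S t ω) ∂P = ∑ i, L.reward i *
      (L.load i + (y₀ i - L.load i) * Real.exp (-L.serviceRate i * t) -
        ∫ ω, ((S t ω).2 i : ℝ) ∂P) := by
  have htotal (i : Fin m) := hS.isChain.integrable_comp (hasExpGrowth_classTotal i) t
  have hfict (i : Fin m) := hS.isChain.integrable_comp (hasExpGrowth_snd i) t
  have hreward (st : L.State) : L.rewardRate st =
      ∑ i, L.reward i * ((st.classTotal i : ℝ) - st.2 i) := by
    simp [rewardRate, State.classTotal]
  simp only [hreward]
  rw [integral_finsetSum]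
  · refine Finset.sum_congr rfl fun i _ => ?_
    rw [integral_const_mul, integral_sub (htotal i) (hfict i), hS.integral_classTotal]
  · exact fun i _ => ((htotal i).sub (hfict i)).const_mul _

/-- The level that the number of class `i` requests in the fictitious system rarely exceeds. -/
def fictLevel (L : LossNetwork m s) (ε : ℝ) (α : L.Fractions) (β : ℝ) (i : Fin m) : ℝ :=
  L.fictCapacity ε α i * (Real.log (s + 1) / β + 1 - ε / 2)

/-- An upper bound for the indicator that a class `i` request is rejected while the fictitious
system is at `fictLevel`. The first term accounts for requests that are not conditionally accepted,
the second one for allocations that do not fit. The factor `s` covers a network without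
resources, in which every request is conditionally accepted. -/
def rejectBound (L : LossNetwork m s) (ε : ℝ) (α : L.Fractions) (β : ℝ) (i : Fin m)
    (st : L.State) : ℝ :=
  s * (2 * Real.exp (ε - β * (1 - ε / 2)) / (s + 1)) * L.mixedPenalty ε α β i st +
    Real.exp (ε - β) * L.usagePenalty ε α β st

namespace IsTarget

lemma le_fictLevel (T : L.IsTarget ε α β) (i : Fin m) :
    (1 - accFrac α i) * L.load i ≤ L.fictLevel ε α β i := by
  have hε := T.eps_pos
  have hlog : 0 ≤ Real.log (s + 1) / β :=
    div_nonneg (Real.log_nonneg (le_add_of_nonneg_left s.cast_nonneg)) T.beta_pos.le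
  have hfactor : 1 ≤ (1 + 4 * ε) * (Real.log (s + 1) / β + 1 - ε / 2) := by
    nlinarith [mul_nonneg hε.le hlog, mul_pos hε (sub_pos.2 T.eps_lt)]
  calc (1 - accFrac α i) * L.load i
      ≤ (1 - accFrac α i) * L.load i *
          ((1 + 4 * ε) * (Real.log (s + 1) / β + 1 - ε / 2)) :=
        le_mul_of_one_le_right
          (mul_nonneg (sub_nonneg.2 (T.accFrac_le_one i)) (L.load_pos i).le) hfactor
    _ = L.fictLevel ε α β i := by
        rw [fictLevel, fictCapacity_eq]
        ring

lemma fictWeight_mul_fictLevel (T : L.IsTarget ε α β) (h : L.fictCapacity ε α i ≠ 0) :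
    L.fictWeight ε α β i * L.fictLevel ε α β i = Real.log (s + 1) + β * (1 - ε / 2) := by
  have hβ := T.beta_pos.ne'
  rw [fictWeight, fictLevel]
  field_simp
  ring

lemma one_le_mixedPenalty_of_not_condAccepted (T : L.IsTarget ε α β) (hi : 0 < accFrac α i)
    (hc : ¬ L.CondAccepted ε α β st i) (hlevel : L.fictLevel ε α β i < st.2 i + 1) :
    1 ≤ 2 * Real.exp (ε - β * (1 - ε / 2)) / (s + 1) * L.mixedPenalty ε α β i st := by
  have hs : (0 : ℝ) < s + 1 := by positivity
  have hexponent : Real.log (s + 1) - (ε - β * (1 - ε / 2)) ≤ L.fictWeight ε α β i * st.2 i := by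
    have hmul := mul_le_mul_of_nonneg_left hlevel.le (T.fictWeight_nonneg i)
    rw [T.fictWeight_mul_fictLevel (fictCapacity_ne_zero_of_not_condAccepted hi hc)] at hmul
    linarith [T.fictWeight_le i]
  have hexp := (Real.exp_le_exp.2 hexponent).trans
    (T.exp_fictWeight_mul_le_of_not_condAccepted hi hc)
  rw [Real.exp_sub, Real.exp_log hs, div_le_iff₀ (Real.exp_pos _)] at hexp
  rw [div_mul_eq_mul_div, le_div_iff₀ hs]
  linarith

lemma rejectBound_fst_nonneg (i : Fin m) (st : L.State) :
    0 ≤ s * (2 * Real.exp (ε - β * (1 - ε / 2)) / (s + 1)) * L.mixedPenalty ε α β i st :=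
  mul_nonneg (by positivity) (mixedPenalty_pos i st).le

lemma rejectBound_snd_nonneg (T : L.IsTarget ε α β) (st : L.State) :
    0 ≤ Real.exp (ε - β) * L.usagePenalty ε α β st :=
  mul_nonneg (Real.exp_pos _).le (T.usagePenalty_nonneg st)

lemma rejectBound_nonneg (T : L.IsTarget ε α β) (i : Fin m) (st : L.State) :
    0 ≤ L.rejectBound ε α β i st :=
  add_nonneg (rejectBound_fst_nonneg i st) (T.rejectBound_snd_nonneg st)

lemma one_le_rejectBound_of_eq_none (T : L.IsTarget ε α β) (hd : L.IsPenaltyRule ε α β d)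
    (hi : 0 < accFrac α i) (hst : d i st = none) (hlevel : L.fictLevel ε α β i < st.2 i + 1) :
    1 ≤ L.rejectBound ε α β i st := by
  by_cases hc : L.CondAccepted ε α β st i
  · obtain ⟨j, -, hj⟩ := hd.reject i st hst hc
    have hexp := mul_le_mul_of_nonneg_left (T.exp_le_usagePenalty_of_not_fits hj)
      (Real.exp_pos (ε - β)).le
    rw [← Real.exp_add, sub_add_sub_cancel, sub_self, Real.exp_zero] at hexp
    exact hexp.trans (le_add_of_nonneg_left (rejectBound_fst_nonneg i st))
  · have hs : (1 : ℝ) ≤ s :=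
      Nat.one_le_cast.2 (Nat.one_le_iff_ne_zero.2 (T.ne_zero_of_not_condAccepted hi hc))
    have hone := T.one_le_mixedPenalty_of_not_condAccepted hi hc hlevel
    calc (1 : ℝ) ≤ s * (2 * Real.exp (ε - β * (1 - ε / 2)) / (s + 1) *
          L.mixedPenalty ε α β i st) := one_le_mul_of_one_le_of_one_le hs hone
      _ ≤ L.rejectBound ε α β i st := by
        rw [← mul_assoc]
        exact le_add_of_nonneg_right (T.rejectBound_snd_nonneg st)

lemma hasExpGrowth_rejectBound (T : L.IsTarget ε α β) (i : Fin m) :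
    (L.dynamics d).HasExpGrowth (L.rejectBound ε α β i) :=
  ((T.hasExpGrowth_mixedPenalty i).const_mul _).add (hasExpGrowth_usagePenalty.const_mul _)

variable [IsProbabilityMeasure P]

lemma integral_rejectBound_le (T : L.IsTarget ε α β) (hd : L.IsPenaltyRule ε α β d)
    (hS : L.IsStateChain d y₀ P ℱ S) (hy₀ : ∀ i, (y₀ i : ℝ) = (1 - accFrac α i) * L.load i)
    (hδ : (s + 1) ^ 2 * Real.exp (-(ε / 2) * (β - 4)) ≤ 1) (i : Fin m) (t : ℝ≥0) :
    ∫ ω, L.rejectBound ε α β i (S t ω) ∂P ≤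
      (s + 1) ^ 2 * Real.exp (-(ε / 2) * (β - 4)) := by
  set c : ℝ := s * (2 * Real.exp (ε - β * (1 - ε / 2)) / (s + 1)) with hc
  have hmixed := hS.isChain.integrable_comp (T.hasExpGrowth_mixedPenalty i) t
  have husage := hS.isChain.integrable_comp (hasExpGrowth_usagePenalty (ε := ε) (α := α) (β := β)) t
  calc ∫ ω, L.rejectBound ε α β i (S t ω) ∂P
      = c * ∫ ω, L.mixedPenalty ε α β i (S t ω) ∂P +
          Real.exp (ε - β) * ∫ ω, L.usagePenalty ε α β (S t ω) ∂P := by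
        simp only [rejectBound]
        rw [integral_add (hmixed.const_mul _) (husage.const_mul _), integral_const_mul,
          integral_const_mul]
    _ ≤ c * ((s + 1) * Real.exp (β * (1 - ε))) +
          Real.exp (ε - β) * (s * (2 * ((s + 1) * Real.exp (β * (1 - ε))))) := by
        gcongr
        · exact T.integral_mixedPenalty_le hd hS (hy₀ i) t
        · exact T.integral_usagePenalty_le hd hS hy₀ t
    _ = 2 * s * (Real.exp (ε - β * (1 - ε / 2)) * Real.exp (β * (1 - ε))) +
          2 * s * (s + 1) * (Real.exp (ε - β) * Real.exp (β * (1 - ε))) := by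
        rw [hc]
        field_simp
    _ = 2 * s * Real.exp (ε - ε / 2 * β) + 2 * s * (s + 1) * Real.exp (ε - ε * β) := by
        rw [← Real.exp_add, ← Real.exp_add]
        ring_nf
    _ ≤ (s + 1) ^ 2 * Real.exp (-(ε / 2) * (β - 4)) :=
        two_mul_exp_add_two_mul_exp_le s T.eps_pos.le hδ

/-- If `α_i ≤ (s + 1)² exp (-(ε / 2) (β - 4))`, then the bound is so weak that it holds even for the
total number of class `i` requests. -/
lemma integral_snd_le (T : L.IsTarget ε α β) (hd : L.IsPenaltyRule ε α β d)
    (hS : L.IsStateChain d y₀ P ℱ S) (hy₀ : ∀ i, (y₀ i : ℝ) = (1 - accFrac α i) * L.load i)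
    (i : Fin m) (t : ℝ≥0) :
    ∫ ω, ((S t ω).2 i : ℝ) ∂P ≤ L.fictLevel ε α β i +
      (s + 1) ^ 2 * Real.exp (-(ε / 2) * (β - 4)) *
        (L.load i * (1 - Real.exp (-L.serviceRate i * t))) := by
  set δ := (s + 1 : ℝ) ^ 2 * Real.exp (-(ε / 2) * (β - 4))
  have hlevel := T.le_fictLevel i
  rcases le_or_gt (accFrac α i) δ with hcase | hcase
  · have hrelax : 0 ≤ L.load i * (1 - Real.exp (-L.serviceRate i * t)) := by
      refine mul_nonneg (L.load_pos i).le (sub_nonneg.2 (Real.exp_le_one_iff.2 ?_))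
      exact mul_nonpos_of_nonpos_of_nonneg (neg_nonpos.2 (L.serviceRate_pos i).le) t.coe_nonneg
    calc ∫ ω, ((S t ω).2 i : ℝ) ∂P
        ≤ ∫ ω, ((S t ω).classTotal i : ℝ) ∂P :=
          integral_mono (hS.isChain.integrable_comp (hasExpGrowth_snd i) t)
            (hS.isChain.integrable_comp (hasExpGrowth_classTotal i) t)
            fun ω => Nat.cast_le.2 (Nat.le_add_left _ _)
      _ = (1 - accFrac α i) * L.load i +
            accFrac α i * (L.load i * (1 - Real.exp (-L.serviceRate i * t))) := by
          rw [hS.integral_classTotal, hy₀]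
          ring
      _ ≤ _ := add_le_add hlevel (mul_le_mul_of_nonneg_right hcase hrelax)
  · have hi : 0 < accFrac α i := lt_trans (by positivity) hcase
    exact hS.integral_snd_le ((hy₀ i).trans_le hlevel) (T.hasExpGrowth_rejectBound i)
      (T.rejectBound_nonneg i) (fun st => T.one_le_rejectBound_of_eq_none hd hi)
      (T.integral_rejectBound_le hd hS hy₀ (hcase.le.trans (T.accFrac_le_one i)) i) t

end IsTarget

end LossNetwork

end

theorem theorem7_general {m s : ℕ} (L : LossNetwork m s) (ε β : ℝ) (hε : 0 < ε) (hε' : ε < 1 / 4)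
    (α : L.Fractions) (hα : L.IsFeasible ε α)
    (hβ : 0 < β) (hβ' : L.IsAdmissible ε α β)
    (y₀ : Fin m → ℕ) (hy₀ : ∀ i, (y₀ i : ℝ) = (1 - ∑ j, α i j) * L.load i)
    (d : L.Rule) (hd : L.IsPenaltyRule ε α β d)
    {Ω : Type*} [mΩ : MeasurableSpace Ω] (P : Measure Ω) [IsProbabilityMeasure P]
    (ℱ : Filtration ℝ≥0 mΩ) (S : ℝ≥0 → Ω → L.State) (hS : L.IsStateChain d y₀ P ℱ S)
    (ζ : ℝ) (hζ : ζ = (Real.log (s + 1) / β + 1 - ε / 2) * (1 + 4 * ε) - 1) (t : ℝ≥0) :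
    Integrable (fun ω => L.rewardRate (S t ω)) P ∧
    ∑ i, (∑ j, α i j) * L.reward i * L.load i * (1 - Real.exp (-L.serviceRate i * t))
      - ζ * ∑ i, (1 - ∑ j, α i j) * L.reward i * L.load i
      - (s + 1) ^ 2 * Real.exp (-(ε / 2) * (β - 4)) *
          ∑ i, L.reward i * L.load i * (1 - Real.exp (-L.serviceRate i * t))
      ≤ ∫ ω, L.rewardRate (S t ω) ∂P := by
  have T : L.IsTarget ε α β := ⟨hα, hβ', hε, hε', hβ⟩
  refine ⟨hS.isChain.integrable_comp LossNetwork.hasExpGrowth_rewardRate t, ?_⟩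
  rw [hS.integral_rewardRate, Finset.mul_sum, Finset.mul_sum, ← Finset.sum_sub_distrib,
    ← Finset.sum_sub_distrib]
  refine Finset.sum_le_sum fun i _ => ?_
  have hfict := mul_le_mul_of_nonneg_left (T.integral_snd_le hd hS hy₀ i t) (L.reward_nonneg i)
  have hlevel : L.fictLevel ε α β i = (1 + ζ) * ((1 - ∑ j, α i j) * L.load i) := by
    rw [LossNetwork.fictLevel, LossNetwork.fictCapacity, hζ]
    ring
  rw [hlevel] at hfict
  rw [hy₀, mul_sub (L.reward i) _ (∫ ω, ((S t ω).2 i : ℝ) ∂P)]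
  linear_combination hfict

theorem theorem7 {m s : ℕ} (L : LossNetwork m s) (ε β : ℝ) (hε : 0 < ε) (hε' : ε < 1 / 4)
    (α : L.Fractions) (hα : L.IsOptimal ε α)
    (hβ : 0 < β) (hβ' : L.IsAdmissible ε α β)
    (y₀ : Fin m → ℕ) (hy₀ : ∀ i, (y₀ i : ℝ) = (1 - ∑ j, α i j) * L.load i)
    (d : L.Rule) (hd : L.IsPenaltyRule ε α β d)
    {Ω : Type*} [mΩ : MeasurableSpace Ω] (P : Measure Ω) [IsProbabilityMeasure P]
    (ℱ : Filtration ℝ≥0 mΩ) (S : ℝ≥0 → Ω → L.State) (hS : L.IsStateChain d y₀ P ℱ S)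
    (ζ : ℝ) (hζ : ζ = (Real.log (s + 1) / β + 1 - ε / 2) * (1 + 4 * ε) - 1) (t : ℝ≥0) :
    Integrable (fun ω => L.rewardRate (S t ω)) P ∧
    ∑ i, (∑ j, α i j) * L.reward i * L.load i * (1 - Real.exp (-L.serviceRate i * t))
      - ζ * ∑ i, (1 - ∑ j, α i j) * L.reward i * L.load i
      - (s + 1) ^ 2 * Real.exp (-(ε / 2) * (β - 4)) *
          ∑ i, L.reward i * L.load i * (1 - Real.exp (-L.serviceRate i * t))
      ≤ ∫ ω, L.rewardRate (S t ω) ∂P :=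
  theorem7_general L ε β hε hε' α hα.1 hβ hβ' y₀ hy₀ d hd P ℱ S hS ζ hζ t
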